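/- **Proposition 3.3.** Let $n\ge 1$, $T>0$, $-\tfrac12<\kappa<0$, $c>0$. On $\mathbb R^{1+n}$ with coordinates $(t,x)$ let $g$ be the Minkowski metric $-dt^2+dx_1^2+\dots+dx_n^2$, with covariant derivative $\nabla$ and wave operator $\Box=g^{\alpha\beta}\nabla_{\alpha\beta}$; indices are raised and lowered with $g$, and repeated indices are summed. Let $r=|x|$, $y=1-r$, let $\partial_r=(0,x/|x|)$, and let $|\slashed\nabla u|$ be the length of the angular gradient of $u$, i.e. of the component of its spatial gradient tangent to the spheres of constant $t$ and $r$. Put $$D\Phi=y^{\kappa}\nabla(y^{-\kappa}\Phi),\qquad \bar D\Phi=y^{-\kappa}\nabla(y^{\kappa}\Phi),\qquad \Box_y=g^{\alpha\beta}\bar D_\alpha D_\beta ,\qquad D_X=X^\alpha D_\alpha,\qquad D_r=D_{\partial_r},$$ $$f=-\frac{1}{1+2\kappa}\,y^{1+2\kappa}-ct^2,\qquad z=-4c,$$ $$w_{f,z}=\frac12\Big(\Box f+\frac{2\kappa}{y}\nabla_\alpha y\nabla^\alpha f\Big)+z,\qquad S_{f,z}=\nabla^\alpha f\cdot D_\alpha+w_{f,z}.$$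 Let $\mathcal C=(-T,T)\times\{|x|<1\}$, and for $0<\varepsilon<\tfrac12$ let $$\mathcal C_\varepsilon=(-T,T)\times\{\varepsilon<r<1-\varepsilon\},\qquad \Gamma_\varepsilon=\big[(-T,T)\times\{r=\varepsilon\}\big]\cup\big[(-T,T)\times\{r=1-\varepsilon\}\big],$$ and let $\nu$ be the outward unit normal of $\mathcal C_\varepsilon$ on $\Gamma_\varepsilon$ (so $\nu=-\partial_r$ on $\{r=\varepsilon\}$ and $\nu=\partial_r$ on $\{r=1-\varepsilon\}$). Integrals over $\mathcal C_\varepsilon$ and $\Gamma_\varepsilon$ are with respect to the volumes induced by $g$. Let $u\in C^\infty(\mathcal C)$ be real-valued and supported on $\mathcal C\cap\{|t|<T-\delta\}$ for some $\delta>0$. Then, for every $0<\varepsilon<\tfrac12$, $$\begin{aligned} -\int_{\mathcal C_\varepsilon}\Box_y u\cdot S_{f,z}u\ \ge\ &\int_{\mathcal C_\varepsilon}\big[(1-4c)|\slashed\nabla u|^2+2c(\partial_tu)^2-4c(D_ru)^2\big]\\ &-\frac12(n-1)\kappa\int_{\mathcal C_\varepsilon}y^{2\kappa-2}r^{-2}\,[\,r-(n-4)y\,]\,u^2\\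 &+\frac14(n-1)(n-3)\int_{\mathcal C_\varepsilon}y^{2\kappa}r^{-3}u^2-\int_{\Gamma_\varepsilon}S_{f,z}u\cdot D_\nu u\\ &+\frac12\int_{\Gamma_\varepsilon}\nabla_\nu f\cdot D_\beta u\,D^\beta u+\frac12\int_{\Gamma_\varepsilon}\nabla_\nu w_{f,z}\cdot u^2\\ &+2\kappa(2\kappa-1)\int_{\Gamma_\varepsilon}y^{2\kappa-2}\,\nabla_\nu y\cdot u^2 . \end{aligned}$$ -/

import Mathlib

open MeasureTheory Set
open scoped ContDiff

namespace TwistedWave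

noncomputable section

/-- The spacetime `ℝ^{1+n}`; a point is `p = (t, x)`, with `x` in Euclidean `n`-space. -/
abbrev Spacetime (n : ℕ) : Type := ℝ × EuclideanSpace ℝ (Fin n)

/-- The Cartesian coordinate frame: index `0` is `∂_t`, index `i + 1` is `∂_{x_i}`.
This frame is parallel for the Minkowski metric, so the components of covariant derivatives
in it are ordinary partial derivatives of components. -/
def frame (n : ℕ) : Fin (n + 1) → Spacetime n :=
  Fin.cons (1, 0) (fun i => (0, EuclideanSpace.single i 1))

/-- The Minkowski metric `diag(-1, 1, …, 1)` in the Cartesian frame. -/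
def minkowski (n : ℕ) : Matrix (Fin (n + 1)) (Fin (n + 1)) ℝ :=
  Matrix.diagonal (Fin.cons (-1) (fun _ => 1))

/-- The Minkowski matrix is its own inverse, so it gives `g_{αβ}` as well as `g^{αβ}`. -/
theorem minkowski_mul_self (n : ℕ) : minkowski n * minkowski n = 1 := by
  rw [minkowski, Matrix.diagonal_mul_diagonal, ← Matrix.diagonal_one]
  congr 1
  funext i
  refine Fin.cases ?_ (fun j => ?_) i <;> simp

/-- The `g`-contraction `g^{αβ} a_α b_β` of two covectors. -/
def contract {n : ℕ} (a b : Spacetime n →L[ℝ] ℝ) : ℝ :=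
  ∑ α, ∑ β, minkowski n α β * a (frame n α) * b (frame n β)

/-- The wave operator `□φ = g^{αβ} ∂_α ∂_β φ`. -/
def waveOp {n : ℕ} (φ : Spacetime n → ℝ) (p : Spacetime n) : ℝ :=
  ∑ α, ∑ β, minkowski n α β *
    fderiv ℝ (fun q => fderiv ℝ φ q (frame n β)) p (frame n α)

/-- `y = 1 - r`, where `r = |x|`. -/
def yFun {n : ℕ} (p : Spacetime n) : ℝ := 1 - ‖p.2‖

/-- The twisted differential `Dφ = y^κ ∇(y^{-κ} φ)` of a scalar function;
`twistedD κ φ p X` is `D_X φ` at `p`. -/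
def twistedD {n : ℕ} (κ : ℝ) (φ : Spacetime n → ℝ) (p : Spacetime n) : Spacetime n →L[ℝ] ℝ :=
  yFun p ^ κ • fderiv ℝ (fun q => yFun q ^ (-κ) * φ q) p

/-- The conjugate twisted differential `D̄φ = y^{-κ} ∇(y^κ φ)`. -/
def twistedDbar {n : ℕ} (κ : ℝ) (φ : Spacetime n → ℝ) (p : Spacetime n) :
    Spacetime n →L[ℝ] ℝ :=
  yFun p ^ (-κ) • fderiv ℝ (fun q => yFun q ^ κ * φ q) p

/-- The twisted wave operator `□_y u = g^{αβ} D̄_α D_β u`. -/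
def twistedWaveOp {n : ℕ} (κ : ℝ) (u : Spacetime n → ℝ) (p : Spacetime n) : ℝ :=
  ∑ α, ∑ β, minkowski n α β *
    twistedDbar κ (fun q => twistedD κ u q (frame n β)) p (frame n α)

/-- The time derivative `∂_t u`. -/
def timeDeriv {n : ℕ} (u : Spacetime n → ℝ) (p : Spacetime n) : ℝ := fderiv ℝ u p (1, 0)

/-- The radial vector field `∂_r = (0, x / |x|)`. -/
def radial {n : ℕ} (p : Spacetime n) : Spacetime n := (0, ‖p.2‖⁻¹ • p.2)

/-- The angular gradient: the component of the spatial gradient tangent to the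
sphere through `p` on which `t` and `r` are constant. -/
def angularGrad {n : ℕ} (u : Spacetime n → ℝ) (p : Spacetime n) : EuclideanSpace ℝ (Fin n) :=
  (ℝ ∙ p.2)ᗮ.starProjection (gradient (fun x => u (p.1, x)) p.2)

/-- `w_{f,z} = (1/2) (□f + (2κ/y) ∇_α y ∇^α f) + z`. -/
def wFun {n : ℕ} (κ : ℝ) (f z : Spacetime n → ℝ) (p : Spacetime n) : ℝ :=
  (1 / 2) * (waveOp f p + 2 * κ / yFun p * contract (fderiv ℝ yFun p) (fderiv ℝ f p)) + z p

/-- The multiplier `S_{f,z} u = ∇^α f D_α u + w_{f,z} u`. -/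
def multiplier {n : ℕ} (κ : ℝ) (f z u : Spacetime n → ℝ) (p : Spacetime n) : ℝ :=
  contract (fderiv ℝ f p) (twistedD κ u p) + wFun κ f z p * u p

/-- `f = -y^{1+2κ} / (1+2κ) - c t²`. -/
def fFun {n : ℕ} (κ c : ℝ) (p : Spacetime n) : ℝ :=
  -(1 / (1 + 2 * κ)) * yFun p ^ (1 + 2 * κ) - c * p.1 ^ 2

/-- `z = -4c`. -/
def zFun {n : ℕ} (c : ℝ) (_p : Spacetime n) : ℝ := -4 * c

/-- The cylinder `𝒞 = (-T, T) × B_1`. -/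
def cylinder (n : ℕ) (T : ℝ) : Set (Spacetime n) :=
  {p | p.1 ∈ Ioo (-T) T ∧ ‖p.2‖ < 1}

/-- The truncated cylinder `𝒞_ε = (-T, T) × {ε < r < 1 - ε}`. -/
def cylinderEps (n : ℕ) (T ε : ℝ) : Set (Spacetime n) :=
  {p | p.1 ∈ Ioo (-T) T ∧ ‖p.2‖ ∈ Ioo ε (1 - ε)}

/-- The outward unit normal of `𝒞_ε` along its timelike boundary `Γ_ε`:
`-∂_r` on the inner component `{r = ε}` and `∂_r` on the outer component `{r = 1 - ε}`. -/
def outwardNormal {n : ℕ} (ε : ℝ) (p : Spacetime n) : Spacetime n :=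
  if ‖p.2‖ = ε then -radial p else radial p

/-- The integral of `F` over `(-T, T) × {r = ρ}` with respect to the induced volume,
which is `ρ^{n-1} dθ dt` in polar coordinates. -/
def lateralIntegral {n : ℕ} (T ρ : ℝ) (F : Spacetime n → ℝ) : ℝ :=
  ∫ t in Ioo (-T) T, ρ ^ (n - 1) *
    ∫ θ : Metric.sphere (0 : EuclideanSpace ℝ (Fin n)) 1,
      F (t, ρ • (θ : EuclideanSpace ℝ (Fin n))) ∂(volume.toSphere)

/-- The integral over `Γ_ε`, the union of `(-T, T) × {r = ε}` and `(-T, T) × {r = 1 - ε}`. -/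
def gammaIntegral {n : ℕ} (T ε : ℝ) (F : Spacetime n → ℝ) : ℝ :=
  lateralIntegral T ε F + lateralIntegral T (1 - ε) F

end

end TwistedWave

open TwistedWave

open TwistedWave

namespace TwistedWave

/-! Put `v = y^{-κ} u` and `ρ = y^{2κ}`. Then `□_y u = y^{-κ} div(ρ∇v)` and `S u = y^κ (∇f·∇v + w
v)`, so the powers of `y` cancel in the product and the classical multiplier identity with weight
`ρ` applies (`divergence_energyField`): `-□_y u · S u` is the divergence of an energy current, plus
`ρ ∇²f(∇v, ∇v)`, plus a multiple of `g(∇v, ∇v)`, minus `½ div(ρ∇w) v²`.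

The choices of `f` and `z` make this work. Since `∂_r f = ρ`, the Hessian of `f` is `ρ/r` on angular
directions, `-2κρ/y > 0` on the radial one and `-2c` on time. Without `z`, `w` would be exactly
`div(ρ∇f)/(2ρ)` and the multiple of `g(∇v, ∇v)` would vanish; the shift `z = -4c` leaves `-4cρ g(∇v,
∇v)`, which turns the time coefficient `-2c` into `2c` and costs `-4c` on spatial derivatives. As `κ
< 0` and `r < 1`, `ρ/r ≥ 1`, whence the angular coefficient `1 - 4c`.

The zero-order term has a bad part of order `y^{-3}`. It is absorbed by the radial term
`-2κ(ρ²/y)(∂_r v)²` through a pointwise Hardy inequality: the square `-2κ(ρ²/y)(∂_r v + (1-2κ)v/y)²`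
is nonnegative, and its cross term is a divergence up to zero-order terms. Adding that divergence to
the energy current gives `carlemanField`; the remaining zero-order terms are exactly those of the
statement, and the discarded ones are the square and `(ρ/r - 1)` times the squared angular gradient
(`divergence_carlemanField_le`).

It remains to integrate. The flux of `carlemanField` is the boundary integrand
(`radialPart_carlemanField`), the Hardy part producing the last term. The divergence theorem on
`𝒞_ε` (`setIntegral_divergence`) is obtained by testing against radial functions: the integral of
`div(φ(r) X)` vanishes for compactly supported `X`, and polar coordinates turn this into a weak
one-dimensional identity between shell integrals of `div X` and of its radial part. Cutting off in
`r` reduces the fields at hand to compactly supported ones. -/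

/-! ### Polar coordinates and integrals over shells -/

theorem integral_eq_integral_polar {n : ℕ} (hn : 1 ≤ n) {G : Spacetime n → ℝ}
    (hG : Integrable G) :
    ∫ p, G p = ∫ r in Ioi (0 : ℝ), r ^ (n - 1) *
      ∫ θ : Metric.sphere (0 : EuclideanSpace ℝ (Fin n)) 1,
        (∫ t, G (t, r • (θ : EuclideanSpace ℝ (Fin n)))) ∂(volume.toSphere) := by
  -- Positive dimension makes the origin a null set, so it may be removed before passing to polar
  -- coordinates.
  have : Nonempty (Fin n) := ⟨⟨0, hn⟩⟩
  set E := EuclideanSpace ℝ (Fin n)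
  set K : E → ℝ := fun x => ∫ t, G (t, x) with hK
  have hG' : Integrable G ((volume : Measure ℝ).prod (volume : Measure E)) := hG
  have hKi : Integrable K := hG'.integral_prod_right
  have hdim : Module.finrank ℝ E = n := by simp [E]
  have hmp := (volume : Measure E).measurePreserving_homeomorphUnitSphereProd
  have hme := Homeomorph.measurableEmbedding (homeomorphUnitSphereProd E)
  set H : Metric.sphere (0 : E) 1 × Ioi (0 : ℝ) → ℝ := fun q => K ((q.2 : ℝ) • (q.1 : E)) with hH
  have hcomp : ∀ x : ({(0 : E)}ᶜ : Set E), H (homeomorphUnitSphereProd E x) = K x := by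
    intro x
    have hx : ‖(x : E)‖ ≠ 0 := norm_ne_zero_iff.2 x.2
    simp [H, smul_smul, hx]
  have hHi : Integrable H (((volume : Measure E).toSphere).prod
      (Measure.volumeIoiPow (Module.finrank ℝ E - 1))) := by
    rw [← hmp.integrable_comp_emb hme]
    have : H ∘ homeomorphUnitSphereProd E = K ∘ Subtype.val := funext hcomp
    rw [this]
    have h2 : IntegrableOn K ({(0 : E)}ᶜ) := hKi.integrableOn
    rwa [integrableOn_iff_comap_subtypeVal (by measurability)] at h2
  calc ∫ p, G p = ∫ x : E, K x := integral_prod_symm G hG'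
    _ = ∫ x : ({(0 : E)}ᶜ : Set E), K x ∂((volume : Measure E).comap (↑)) := by
      rw [integral_subtype_comap (measurableSet_singleton _).compl K,
        restrict_compl_singleton]
    _ = ∫ q, H q ∂(((volume : Measure E).toSphere).prod
          (Measure.volumeIoiPow (Module.finrank ℝ E - 1))) := by
      rw [← hmp.integral_comp hme]
      simp only [hcomp]
    _ = ∫ r : Ioi (0 : ℝ), (∫ θ, H (θ, r) ∂((volume : Measure E).toSphere))
          ∂(Measure.volumeIoiPow (Module.finrank ℝ E - 1)) := integral_prod_symm H hHi
    _ = _ := by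
      rw [hdim]
      simp only [Measure.volumeIoiPow, ENNReal.ofReal]
      rw [integral_withDensity_eq_integral_smul
          ((measurable_subtype_coe.pow_const _).real_toNNReal),
        integral_subtype_comap measurableSet_Ioi fun a : ℝ ↦ Real.toNNReal (a ^ (n - 1)) •
          ∫ θ : Metric.sphere (0 : E) 1, K (a • (θ : E)) ∂((volume : Measure E).toSphere)]
      refine setIntegral_congr_fun measurableSet_Ioi fun x hx ↦ ?_
      simp only [NNReal.smul_def, Real.coe_toNNReal _ (pow_nonneg (le_of_lt hx) _), smul_eq_mul, hK]

/-- The integral of `F` over the cylinder `ℝ × {|x| = r}`. -/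
noncomputable def shellIntegral {n : ℕ} (F : Spacetime n → ℝ) (r : ℝ) : ℝ :=
  r ^ (n - 1) * ∫ θ : Metric.sphere (0 : EuclideanSpace ℝ (Fin n)) 1,
    (∫ t, F (t, r • (θ : EuclideanSpace ℝ (Fin n)))) ∂(volume.toSphere)

theorem continuous_shellIntegral {n : ℕ} {F : Spacetime n → ℝ} (hF : Continuous F)
    (hc : HasCompactSupport F) : Continuous (shellIntegral F) := by
  obtain ⟨R, hR⟩ := hc.isCompact.isBounded.subset_closedBall 0
  have hz : ∀ t x, t ∉ Icc (-R) R → F (t, x) = 0 := by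
    intro t x ht
    by_contra h
    have := hR (subset_tsupport _ h)
    rw [mem_closedBall_zero_iff] at this
    have h1 : |t| ≤ R := (norm_fst_le ((t, x) : Spacetime n)).trans this
    exact ht (abs_le.1 h1)
  have h1 : Continuous fun q : ℝ × Metric.sphere (0 : EuclideanSpace ℝ (Fin n)) 1 =>
      ∫ t, F (t, q.1 • (q.2 : EuclideanSpace ℝ (Fin n))) := by
    -- Compact support confines the time integral to a fixed compact interval, where continuity in
    -- the parameters is available.
    have : (fun q : ℝ × Metric.sphere (0 : EuclideanSpace ℝ (Fin n)) 1 =>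
      ∫ t, F (t, q.1 • (q.2 : EuclideanSpace ℝ (Fin n)))) = fun q =>
      ∫ t in Icc (-R) R, F (t, q.1 • (q.2 : EuclideanSpace ℝ (Fin n))) := by
      funext q
      exact (setIntegral_eq_integral_of_forall_compl_eq_zero fun t ht => hz t _ ht).symm
    rw [this]
    exact continuous_parametric_integral_of_continuous (by fun_prop) isCompact_Icc
  unfold shellIntegral
  refine (continuous_pow _).mul ?_
  have := continuous_parametric_integral_of_continuous
    (μ := (volume : Measure (EuclideanSpace ℝ (Fin n))).toSphere) (s := univ)
    (f := fun (r : ℝ) (θ : Metric.sphere (0 : EuclideanSpace ℝ (Fin n)) 1) =>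
      ∫ t, F (t, r • (θ : EuclideanSpace ℝ (Fin n)))) h1 isCompact_univ
  simpa using this

/-! ### The divergence theorem between two shells -/

/-- The coordinate divergence of the vector field with components `X`. -/
noncomputable def divergence {n : ℕ} (X : Fin (n + 1) → Spacetime n → ℝ) (p : Spacetime n) : ℝ :=
  ∑ α, fderiv ℝ (X α) p (frame n α)

/-- The radial component of the vector field with components `X`. -/
noncomputable def radialPart {n : ℕ} (X : Fin (n + 1) → Spacetime n → ℝ) (p : Spacetime n) : ℝ :=
  ∑ i : Fin n, ‖p.2‖⁻¹ * p.2 i * X i.succ p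

/-- Integration by parts against the constant function 1. -/
theorem integral_fderiv_eq_zero {n : ℕ} {F : Spacetime n → ℝ} (hF : ContDiff ℝ 1 F)
    (hc : HasCompactSupport F) (v : Spacetime n) : ∫ p, fderiv ℝ F p v = 0 := by
  have hH : (volume : Measure (Spacetime n)).IsAddHaarMeasure :=
    Measure.prod.instIsAddHaarMeasure volume volume
  have h := integral_mul_fderiv_eq_neg_fderiv_mul_of_integrable (μ := (volume : Measure (Spacetime n)))
    (f := fun _ => (1 : ℝ)) (g := F) (v := v) (by simp) ?_ ?_ (by fun_prop)
    (fun x _ => hF.differentiable (by simp) x)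
  · simpa using h
  · simp only [one_mul]
    exact ((hF.continuous_fderiv (by simp)).clm_apply continuous_const).integrable_of_hasCompactSupport
      ((hc.fderiv (𝕜 := ℝ)).comp_left (g := fun L : Spacetime n →L[ℝ] ℝ => L v) rfl)
  · simp only [one_mul]
    exact hF.continuous.integrable_of_hasCompactSupport hc

theorem integral_divergence_eq_zero {n : ℕ} {X : Fin (n + 1) → Spacetime n → ℝ}
    (hX : ∀ α, ContDiff ℝ 1 (X α)) (hc : ∀ α, HasCompactSupport (X α)) :
    ∫ p, divergence X p = 0 := by
  unfold divergence
  rw [integral_finsetSum]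
  · exact Finset.sum_eq_zero fun α _ => integral_fderiv_eq_zero (hX α) (hc α) _
  · intro α _
    exact (((hX α).continuous_fderiv (by simp)).clm_apply
      continuous_const).integrable_of_hasCompactSupport
      (((hc α).fderiv (𝕜 := ℝ)).comp_left (g := fun L : Spacetime n →L[ℝ] ℝ => L _) rfl)

open Filter Topology in
-- The norm is singular only on the axis, and `F` vanishes near it.
theorem contDiff_comp_norm_mul {n : ℕ} {k : WithTop ℕ∞} {φ : ℝ → ℝ} (hφ : ContDiff ℝ k φ)
    {F : Spacetime n → ℝ} (hF : ContDiff ℝ k F) {ρ : ℝ} (hρ : 0 < ρ)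
    (h0 : ∀ p : Spacetime n, ‖p.2‖ < ρ → F p = 0) :
    ContDiff ℝ k fun p : Spacetime n => φ ‖p.2‖ * F p := by
  rw [contDiff_iff_contDiffAt]
  intro p
  by_cases hp : p.2 = 0
  · have : (fun p : Spacetime n => φ ‖p.2‖ * F p) =ᶠ[𝓝 p] fun _ => 0 := by
      have ho : IsOpen {q : Spacetime n | ‖q.2‖ < ρ} := isOpen_lt (by fun_prop) (by fun_prop)
      filter_upwards [ho.mem_nhds (by simpa [hp] using hρ)] with q hq
      rw [h0 q hq, mul_zero]
    exact contDiffAt_const.congr_of_eventuallyEq this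
  · exact (hφ.contDiffAt.comp p (contDiffAt_snd.norm ℝ hp)).mul hF.contDiffAt

theorem continuous_radialPart {n : ℕ} {X : Fin (n + 1) → Spacetime n → ℝ}
    (hX : ∀ α, Continuous (X α)) {ρ : ℝ} (hρ : 0 < ρ)
    (h0 : ∀ α, ∀ p : Spacetime n, ‖p.2‖ < ρ → X α p = 0) : Continuous (radialPart X) := by
  -- Where the maximum differs from the norm the field is zero, and the new denominator never
  -- vanishes.
  have : radialPart X = fun p => ∑ i : Fin n, (max ρ ‖p.2‖)⁻¹ * p.2 i * X i.succ p := by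
    funext p
    refine Finset.sum_congr rfl fun i _ => ?_
    rcases lt_or_ge ‖p.2‖ ρ with h | h
    · rw [h0 _ p h]; simp
    · rw [max_eq_right h]
  rw [this]
  refine continuous_finsetSum _ fun i _ => ?_
  refine (Continuous.mul (Continuous.inv₀ (by fun_prop) fun p => ?_) (by fun_prop)).mul (hX _)
  exact (lt_max_of_lt_left hρ).ne'

/-- The derivative of a function of the radius. -/
theorem hasFDerivAt_comp_norm {n : ℕ} {G : ℝ → ℝ} {G' : ℝ} {p : Spacetime n} (hp : p.2 ≠ 0)
    (hG : HasDerivAt G G' ‖p.2‖) :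
    HasFDerivAt (fun q : Spacetime n => G ‖q.2‖)
      ((G' * ‖p.2‖⁻¹) • (innerSL ℝ p.2).comp (ContinuousLinearMap.snd ℝ ℝ _)) p := by
  have h1 : HasFDerivAt (fun x : EuclideanSpace ℝ (Fin n) => ‖x‖) (‖p.2‖⁻¹ • innerSL ℝ p.2) p.2 := by
    have h2 := (hasStrictFDerivAt_norm_sq p.2).hasFDerivAt.sqrt (by simpa using hp)
    simp only [Real.sqrt_sq (norm_nonneg _)] at h2
    refine h2.congr_fderiv ?_
    ext v
    have : ‖p.2‖ ≠ 0 := norm_ne_zero_iff.2 hp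
    simp [nsmul_eq_mul]
    field_simp
  refine (hG.comp_hasFDerivAt p (h1.comp p hasFDerivAt_snd)).congr_fderiv ?_
  ext v <;> simp [mul_assoc]

theorem fderiv_comp_norm_frame_succ {n : ℕ} {G : ℝ → ℝ} {G' : ℝ} {p : Spacetime n} (hp : p.2 ≠ 0)
    (hG : HasDerivAt G G' ‖p.2‖) (i : Fin n) :
    fderiv ℝ (fun q : Spacetime n => G ‖q.2‖) p (frame n i.succ) = G' * (‖p.2‖⁻¹ * p.2 i) := by
  rw [(hasFDerivAt_comp_norm hp hG).fderiv]
  simp [frame, EuclideanSpace.inner_single_right, mul_assoc]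

theorem fderiv_comp_norm_frame_zero {n : ℕ} {G : ℝ → ℝ} {G' : ℝ} {p : Spacetime n} (hp : p.2 ≠ 0)
    (hG : HasDerivAt G G' ‖p.2‖) :
    fderiv ℝ (fun q : Spacetime n => G ‖q.2‖) p (frame n 0) = 0 := by
  rw [(hasFDerivAt_comp_norm hp hG).fderiv]
  simp [frame]

open Filter Topology in
theorem divergence_comp_norm_mul {n : ℕ} {φ g : ℝ → ℝ} (hφ : ∀ r, HasDerivAt φ (g r) r)
    {X : Fin (n + 1) → Spacetime n → ℝ} (hX : ∀ α, ContDiff ℝ 1 (X α)) {ρ : ℝ} (hρ : 0 < ρ)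
    (h0 : ∀ α, ∀ p : Spacetime n, ‖p.2‖ < ρ → X α p = 0) (p : Spacetime n) :
    divergence (fun α q => φ ‖q.2‖ * X α q) p
      = φ ‖p.2‖ * divergence X p + g ‖p.2‖ * radialPart X p := by
  by_cases hp : p.2 = 0
  · have ho : IsOpen {q : Spacetime n | ‖q.2‖ < ρ} := isOpen_lt (by fun_prop) (by fun_prop)
    have hm := ho.mem_nhds (show p ∈ {q : Spacetime n | ‖q.2‖ < ρ} by simpa [hp] using hρ)
    have e1 : ∀ α, fderiv ℝ (X α) p = 0 := fun α => by
      have : X α =ᶠ[𝓝 p] fun _ => 0 := by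
        filter_upwards [hm] with q hq using h0 α q hq
      rw [this.fderiv_eq]; simp
    have e2 : ∀ α, fderiv ℝ (fun q : Spacetime n => φ ‖q.2‖ * X α q) p = 0 := fun α => by
      have : (fun q : Spacetime n => φ ‖q.2‖ * X α q) =ᶠ[𝓝 p] fun _ => 0 := by
        filter_upwards [hm] with q hq
        rw [h0 α q hq, mul_zero]
      rw [this.fderiv_eq]; simp
    simp [divergence, radialPart, e1, e2, hp]
  · have hd := hasFDerivAt_comp_norm hp (hφ ‖p.2‖)
    have e : ∀ α, fderiv ℝ (fun q : Spacetime n => φ ‖q.2‖ * X α q) p (frame n α)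
        = φ ‖p.2‖ * fderiv ℝ (X α) p (frame n α)
          + fderiv ℝ (fun q : Spacetime n => φ ‖q.2‖) p (frame n α) * X α p := fun α => by
      rw [fderiv_fun_mul hd.differentiableAt ((hX α).differentiable (by simp) p)]
      simp [mul_comm]
    simp only [divergence, e, Finset.sum_add_distrib, ← Finset.mul_sum]
    congr 1
    rw [Fin.sum_univ_succ, fderiv_comp_norm_frame_zero hp (hφ _), zero_mul, zero_add, radialPart,
      Finset.mul_sum]
    refine Finset.sum_congr rfl fun i _ => ?_
    rw [fderiv_comp_norm_frame_succ hp (hφ _)]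
    ring

theorem shellIntegral_comp_norm_mul {n : ℕ} (φ : ℝ → ℝ) (F : Spacetime n → ℝ) {r : ℝ}
    (hr : 0 < r) : shellIntegral (fun p => φ ‖p.2‖ * F p) r = φ r * shellIntegral F r := by
  have : ∀ θ : Metric.sphere (0 : EuclideanSpace ℝ (Fin n)) 1,
      ‖r • (θ : EuclideanSpace ℝ (Fin n))‖ = r := fun θ => by
    rw [norm_smul, Real.norm_of_nonneg hr.le]; simp
  simp only [shellIntegral, this, integral_const_mul]
  ring

theorem shellIntegral_eq_zero {n : ℕ} {F : Spacetime n → ℝ} {R : ℝ} (hR : 0 < R)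
    (hF : ∀ p : Spacetime n, R ≤ ‖p.2‖ → F p = 0) {r : ℝ} (hr : R ≤ r) :
    shellIntegral F r = 0 := by
  have : ∀ θ : Metric.sphere (0 : EuclideanSpace ℝ (Fin n)) 1, ∀ t,
      F (t, r • (θ : EuclideanSpace ℝ (Fin n))) = 0 := fun θ t => hF _ (by
    rw [norm_smul, Real.norm_of_nonneg (hR.le.trans hr)]; simpa using hr)
  simp [shellIntegral, this]

theorem continuous_divergence {n : ℕ} {X : Fin (n + 1) → Spacetime n → ℝ}
    (hX : ∀ α, ContDiff ℝ 1 (X α)) : Continuous (divergence X) :=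
  continuous_finsetSum _ fun α _ =>
    ((hX α).continuous_fderiv (by simp)).clm_apply continuous_const

theorem hasCompactSupport_divergence {n : ℕ} {X : Fin (n + 1) → Spacetime n → ℝ}
    (hc : ∀ α, HasCompactSupport (X α)) : HasCompactSupport (divergence X) := by
  refine HasCompactSupport.of_support_subset_isCompact
    (K := ⋃ α, tsupport (X α)) (isCompact_iUnion fun α => hc α) fun p hp => ?_
  by_contra h
  simp only [mem_iUnion, not_exists] at h
  refine hp (Finset.sum_eq_zero fun α _ => ?_)
  rw [fderiv_of_notMem_tsupport (𝕜 := ℝ) (h α)]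
  simp

theorem hasCompactSupport_radialPart {n : ℕ} {X : Fin (n + 1) → Spacetime n → ℝ}
    (hc : ∀ α, HasCompactSupport (X α)) : HasCompactSupport (radialPart X) := by
  refine HasCompactSupport.of_support_subset_isCompact
    (K := ⋃ α, tsupport (X α)) (isCompact_iUnion fun α => hc α) fun p hp => ?_
  by_contra h
  simp only [mem_iUnion, not_exists] at h
  refine hp (Finset.sum_eq_zero fun i _ => ?_)
  rw [image_eq_zero_of_notMem_tsupport (h i.succ), mul_zero]

theorem integral_comp_norm_mul {n : ℕ} (hn : 1 ≤ n) {φ : ℝ → ℝ} (hφ : Continuous φ)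
    {F : Spacetime n → ℝ} (hF : Continuous F) (hc : HasCompactSupport F) {R : ℝ} (hR : 0 < R)
    (hRF : ∀ p : Spacetime n, R ≤ ‖p.2‖ → F p = 0) :
    ∫ p, φ ‖p.2‖ * F p = ∫ r in 0..R, φ r * shellIntegral F r := by
  have hi : Integrable fun p : Spacetime n => φ ‖p.2‖ * F p :=
    Continuous.integrable_of_hasCompactSupport (by fun_prop) hc.mul_left
  rw [integral_eq_integral_polar hn hi, intervalIntegral.integral_of_le hR.le]
  have : ∫ r in Ioi (0 : ℝ), φ r * shellIntegral F r = ∫ r in Ioc 0 R, φ r * shellIntegral F r := by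
    refine (setIntegral_eq_of_subset_of_forall_sdiff_eq_zero measurableSet_Ioi
      (fun r hr => hr.1) fun r hr => ?_)
    have : R ≤ r := by
      by_contra h
      exact hr.2 ⟨hr.1, (not_le.1 h).le⟩
    rw [shellIntegral_eq_zero hR hRF this, mul_zero]
  rw [← this]
  exact setIntegral_congr_fun measurableSet_Ioi fun r hr => shellIntegral_comp_norm_mul φ F hr

/-- With `h` and `m` the shell integrals of the divergence and of the radial part, the vanishing of
the integral of `div(φ(r) X)` says that `∫ φ h + ∫ φ' m = 0` for every radial `φ`, a weak form of
`m' = h`. Since `m` vanishes at `R`, this determines `m`. -/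
theorem integral_shellIntegral_divergence {n : ℕ} (hn : 1 ≤ n)
    {X : Fin (n + 1) → Spacetime n → ℝ}
    (hX : ∀ α, ContDiff ℝ 1 (X α)) (hc : ∀ α, HasCompactSupport (X α)) {ρ : ℝ} (hρ : 0 < ρ)
    (h0 : ∀ α, ∀ p : Spacetime n, ‖p.2‖ < ρ → X α p = 0) {R : ℝ} (hR : 0 < R)
    (hRX : ∀ α, ∀ p : Spacetime n, R ≤ ‖p.2‖ → X α p = 0) {a : ℝ} (ha : 0 < a) (haR : a < R) :
    ∫ r in a..R, shellIntegral (divergence X) r = -shellIntegral (radialPart X) a := by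
  set h := shellIntegral (divergence X) with hh
  set m := shellIntegral (radialPart X) with hm
  have hXc : ∀ α, Continuous (X α) := fun α => (hX α).continuous
  have hdc := continuous_divergence hX
  have hds := hasCompactSupport_divergence hc
  have hrc := continuous_radialPart hXc hρ h0
  have hrs := hasCompactSupport_radialPart hc
  have hhc : Continuous h := continuous_shellIntegral hdc hds
  have hmc : Continuous m := continuous_shellIntegral hrc hrs
  have hrR : ∀ p : Spacetime n, R ≤ ‖p.2‖ → radialPart X p = 0 := fun p hp =>
    Finset.sum_eq_zero fun i _ => by rw [hRX _ p hp, mul_zero]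
  have hdR : ∀ p : Spacetime n, R ≤ ‖p.2‖ → divergence X p = 0 := by
    -- `X` is locally zero only for `‖x‖ > R`; the sphere `‖x‖ = R` is reached by continuity,
    -- approaching it by dilations with factor decreasing to 1.
    have hcl : closure {p : Spacetime n | R < ‖p.2‖} ⊆ {p | divergence X p = 0} := by
      refine closure_minimal (fun p hp => ?_) (isClosed_eq hdc continuous_const)
      refine Finset.sum_eq_zero fun α _ => ?_
      have ho : IsOpen {q : Spacetime n | R < ‖q.2‖} := isOpen_lt (by fun_prop) (by fun_prop)
      have : X α =ᶠ[nhds p] fun _ => 0 := by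
        filter_upwards [ho.mem_nhds hp] with q hq using hRX α q (le_of_lt hq)
      rw [this.fderiv_eq]; simp
    intro p hp
    refine hcl ?_
    have ht : Filter.Tendsto (fun s : ℝ => ((p.1, s • p.2) : Spacetime n)) (nhdsWithin 1 (Ioi 1))
        (nhds p) := by
      have : Continuous (fun s : ℝ => ((p.1, s • p.2) : Spacetime n)) := by fun_prop
      have h2 := this.tendsto 1
      simp only [one_smul] at h2
      exact h2.mono_left nhdsWithin_le_nhds
    refine mem_closure_of_tendsto ht ?_
    filter_upwards [self_mem_nhdsWithin] with s hs
    have hs' : (1 : ℝ) < s := hs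
    show R < ‖s • p.2‖
    rw [norm_smul, Real.norm_of_nonneg (by linarith : (0 : ℝ) ≤ s)]
    nlinarith
  set H : ℝ → ℝ := fun r => ∫ s in r..R, h s with hH
  have hHd : ∀ r, HasDerivAt H (-h r) r := fun r =>
    intervalIntegral.integral_hasDerivAt_left (hhc.intervalIntegrable _ _)
      (hhc.stronglyMeasurableAtFilter _ _) hhc.continuousAt
  have hHc : Continuous H := continuous_iff_continuousAt.2 fun r => (hHd r).continuousAt
  have key : ∀ g : ℝ → ℝ, Continuous g → ∫ r in 0..R, g r * (H r + m r) = 0 := by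
    intro g hg
    -- An arbitrary continuous `g` is tested by using its primitive as radial factor. Integrating `φ
    -- h = -φ H'` by parts leaves no boundary term, because `φ 0 = 0` and `H R = 0`.
    set φ : ℝ → ℝ := fun r => ∫ s in 0..r, g s with hφdef
    have hφ : ∀ r, HasDerivAt φ (g r) r := fun r =>
      intervalIntegral.integral_hasDerivAt_right (hg.intervalIntegrable _ _)
        (hg.stronglyMeasurableAtFilter _ _) hg.continuousAt
    have hφ1 : ContDiff ℝ 1 φ := by
      rw [contDiff_one_iff_deriv]
      refine ⟨fun r => (hφ r).differentiableAt, ?_⟩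
      rwa [funext fun r => (hφ r).deriv]
    have hφc := hφ1.continuous
    have e0 := integral_divergence_eq_zero (X := fun α q => φ ‖q.2‖ * X α q)
      (fun α => contDiff_comp_norm_mul hφ1 (hX α) hρ (h0 α)) (fun α => (hc α).mul_left)
    simp only [divergence_comp_norm_mul hφ hX hρ h0] at e0
    have i1 : Integrable fun p : Spacetime n => φ ‖p.2‖ * divergence X p :=
      Continuous.integrable_of_hasCompactSupport (by fun_prop) hds.mul_left
    have i2 : Integrable fun p : Spacetime n => g ‖p.2‖ * radialPart X p :=
      Continuous.integrable_of_hasCompactSupport (by fun_prop) hrs.mul_left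
    rw [integral_add i1 i2,
      integral_comp_norm_mul hn hφc hdc hds hR hdR, integral_comp_norm_mul hn hg hrc hrs hR hrR]
      at e0
    have e1 := intervalIntegral.integral_mul_deriv_eq_deriv_mul (a := 0) (b := R)
      (fun r _ => hφ r) (fun r _ => hHd r) (hg.intervalIntegrable _ _)
      (hhc.neg.intervalIntegrable _ _)
    have eR : H R = 0 := intervalIntegral.integral_same
    have e00 : φ 0 = 0 := intervalIntegral.integral_same
    rw [eR, e00] at e1
    simp only [mul_neg, intervalIntegral.integral_neg] at e1
    simp only [mul_add]
    have i3 : IntervalIntegrable (fun r => g r * H r) volume 0 R :=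
      (hg.mul hHc).intervalIntegrable _ _
    have i4 : IntervalIntegrable (fun r => g r * m r) volume 0 R :=
      (hg.mul hmc).intervalIntegrable _ _
    rw [intervalIntegral.integral_add i3 i4]
    linarith
  -- The fundamental lemma of the calculus of variations gives the identity almost everywhere;
  -- continuity gives it at every radius.
  have hsum : EqOn (fun r => H r + m r) (fun _ => 0) (Ioo 0 R) := by
    refine Measure.eqOn_open_of_ae_eq (μ := volume) ?_ isOpen_Ioo
      (hHc.add hmc).continuousOn continuousOn_const
    rw [Filter.EventuallyEq, ae_restrict_iff' measurableSet_Ioo]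
    refine isOpen_Ioo.ae_eq_zero_of_integral_contDiff_smul_eq_zero
      ((hHc.add hmc).locallyIntegrable.locallyIntegrableOn _) fun g hg _ hgs => ?_
    rw [← key g hg.continuous, intervalIntegral.integral_of_le hR.le]
    refine (setIntegral_eq_integral_of_forall_compl_eq_zero fun r hr => ?_).symm
    rw [image_eq_zero_of_notMem_tsupport fun h => hr (Ioo_subset_Ioc_self (hgs h)), zero_smul]
  have := hsum ⟨ha, haR⟩
  simp only [hH] at this
  linarith

theorem integral_shellIntegral_divergence_Ioo {n : ℕ} (hn : 1 ≤ n)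
    {X : Fin (n + 1) → Spacetime n → ℝ}
    (hX : ∀ α, ContDiff ℝ 1 (X α)) (hc : ∀ α, HasCompactSupport (X α)) {ρ : ℝ} (hρ : 0 < ρ)
    (h0 : ∀ α, ∀ p : Spacetime n, ‖p.2‖ < ρ → X α p = 0) {R : ℝ}
    (hRX : ∀ α, ∀ p : Spacetime n, R ≤ ‖p.2‖ → X α p = 0) {a b : ℝ} (ha : 0 < a) (hab : a < b)
    (hbR : b < R) :
    ∫ r in a..b, shellIntegral (divergence X) r
      = shellIntegral (radialPart X) b - shellIntegral (radialPart X) a := by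
  have h1 := integral_shellIntegral_divergence hn hX hc hρ h0 (by linarith) hRX ha (hab.trans hbR)
  have h2 := integral_shellIntegral_divergence hn hX hc hρ h0 (by linarith) hRX (ha.trans hab) hbR
  have hcont := continuous_shellIntegral (continuous_divergence hX) (hasCompactSupport_divergence hc)
  rw [← intervalIntegral.integral_add_adjacent_intervals (b := b)
    (hcont.intervalIntegrable _ _) (hcont.intervalIntegrable _ _)] at h1
  linarith

/-! ### Cutting off functions that are smooth off the axis -/

/-- The cylinder with its axis removed. -/
def puncturedCylinder (n : ℕ) (T : ℝ) : Set (Spacetime n) :=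
  {p | p.1 ∈ Ioo (-T) T ∧ ‖p.2‖ ∈ Ioo 0 1}

theorem isOpen_puncturedCylinder (n : ℕ) (T : ℝ) : IsOpen (puncturedCylinder n T) :=
  (isOpen_Ioo.preimage continuous_fst).inter
    (isOpen_Ioo.preimage (continuous_norm.comp continuous_snd))

theorem isOpen_cylinderEps (n : ℕ) (T ε : ℝ) : IsOpen (cylinderEps n T ε) :=
  (isOpen_Ioo.preimage continuous_fst).inter
    (isOpen_Ioo.preimage (continuous_norm.comp continuous_snd))

theorem cylinderEps_subset {n : ℕ} {T ε : ℝ} (hε : 0 < ε) :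
    cylinderEps n T ε ⊆ puncturedCylinder n T := fun _ hp =>
  ⟨hp.1, hε.trans hp.2.1, hp.2.2.trans (by linarith)⟩

/-- Being of class `C^k` off the axis of the cylinder and zero at times `|t| > T - δ`. -/
structure Admissible {n : ℕ} (T δ : ℝ) (k : WithTop ℕ∞) (F : Spacetime n → ℝ) : Prop where
  contDiffOn : ContDiffOn ℝ k F (puncturedCylinder n T)
  -- The strict inequality makes the region open, so that derivatives of `F` vanish there as well.
  eq_zero : ∀ p ∈ puncturedCylinder n T, T - δ < |p.1| → F p = 0

open Filter Topology in
-- A radial cutoff removes the axis and the boundary `r = 1`, while the vanishing of `F` for late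
-- and early times allows extension by zero across `|t| = T`. The extension agrees with `F` on a
-- neighbourhood of the closed range `ε ≤ r ≤ 1 - ε`, so both integrals over `𝒞_ε` and fluxes
-- through its boundary are unchanged.
theorem Admissible.exists_extension {n : ℕ} {T δ : ℝ} (hδ : 0 < δ) {k : ℕ∞}
    {F : Spacetime n → ℝ} (hF : Admissible T δ k F) {ε : ℝ} (hε : 0 < ε) :
    ∃ G : Spacetime n → ℝ, ContDiff ℝ k G ∧ HasCompactSupport G ∧
      (∀ p : Spacetime n, ‖p.2‖ < ε / 4 → G p = 0) ∧
      (∀ p : Spacetime n, 1 - ε / 4 ≤ ‖p.2‖ → G p = 0) ∧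
      (∀ p : Spacetime n, T - δ < |p.1| → G p = 0) ∧
      ∀ p ∈ puncturedCylinder n T, ‖p.2‖ ∈ Ioo (ε / 2) (1 - ε / 2) → G p = F p := by
  classical
  set χ : ℝ → ℝ := fun r => Real.smoothTransition ((r - ε / 4) / (ε / 4)) *
    Real.smoothTransition ((1 - ε / 4 - r) / (ε / 4)) with hχ
  have hχs : ContDiff ℝ k χ :=
    (Real.smoothTransition.contDiff.comp (by fun_prop)).mul
      (Real.smoothTransition.contDiff.comp (by fun_prop))
  have hχ0 : ∀ r, r ≤ ε / 4 → χ r = 0 := fun r hr => by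
    simp only [hχ]
    rw [Real.smoothTransition.zero_of_nonpos
      (div_nonpos_of_nonpos_of_nonneg (by linarith) (by linarith)), zero_mul]
  have hχ1 : ∀ r, 1 - ε / 4 ≤ r → χ r = 0 := fun r hr => by
    simp only [hχ]
    rw [Real.smoothTransition.zero_of_nonpos (x := (1 - ε / 4 - r) / (ε / 4))
      (div_nonpos_of_nonpos_of_nonneg (by linarith) (by linarith)), mul_zero]
  have hχe : ∀ r, ε / 2 < r → r < 1 - ε / 2 → χ r = 1 := fun r h1 h2 => by
    simp only [hχ]
    rw [Real.smoothTransition.one_of_one_le ((one_le_div (by linarith)).2 (by linarith)),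
      Real.smoothTransition.one_of_one_le ((one_le_div (by linarith)).2 (by linarith)), mul_one]
  set G : Spacetime n → ℝ := fun p => if p ∈ puncturedCylinder n T then χ ‖p.2‖ * F p else 0
    with hG
  have z0 : ∀ p : Spacetime n, ‖p.2‖ < ε / 4 → G p = 0 := fun p hp => by
    simp only [hG]; rw [hχ0 _ hp.le]; simp
  have z1 : ∀ p : Spacetime n, 1 - ε / 4 ≤ ‖p.2‖ → G p = 0 := fun p hp => by
    simp only [hG]; rw [hχ1 _ hp]; simp
  have zt : ∀ p : Spacetime n, T - δ < |p.1| → G p = 0 := fun p hp => by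
    simp only [hG]
    split_ifs with h
    · rw [hF.eq_zero p h hp, mul_zero]
    · rfl
  have hzero : ∀ {s : Set (Spacetime n)} {p}, IsOpen s → p ∈ s → (∀ q ∈ s, G q = 0) →
      ContDiffAt ℝ k G p := fun {s p} hs hp h =>
    (contDiffAt_const (c := (0 : ℝ))).congr_of_eventuallyEq
      (by filter_upwards [hs.mem_nhds hp] with q hq using h q hq)
  refine ⟨G, ?_, ?_, z0, z1, zt, ?_⟩
  · rw [contDiff_iff_contDiffAt]
    intro p
    by_cases hp : p ∈ puncturedCylinder n T
    · have hp2 : p.2 ≠ 0 := norm_pos_iff.1 hp.2.1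
      have e : G =ᶠ[𝓝 p] fun q => χ ‖q.2‖ * F q := by
        filter_upwards [(isOpen_puncturedCylinder n T).mem_nhds hp] with q hq
        simp only [hG, if_pos hq]
      exact ((hχs.contDiffAt.comp p (contDiffAt_snd.norm ℝ hp2)).mul
        (hF.contDiffOn.contDiffAt ((isOpen_puncturedCylinder n T).mem_nhds hp))).congr_of_eventuallyEq e
    · by_cases h1 : ‖p.2‖ < ε / 4
      · exact hzero (s := {q | ‖q.2‖ < ε / 4}) (isOpen_lt (by fun_prop) (by fun_prop)) h1 z0
      by_cases h2 : 1 - ε / 4 < ‖p.2‖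
      · exact hzero (s := {q | 1 - ε / 4 < ‖q.2‖}) (isOpen_lt (by fun_prop) (by fun_prop)) h2
          fun q hq => z1 q (le_of_lt hq)
      by_cases h3 : T - δ < |p.1|
      · exact hzero (s := {q | T - δ < |q.1|}) (isOpen_lt (by fun_prop) (by fun_prop)) h3 zt
      -- The three open zero regions and the punctured cylinder cover spacetime: outside the former,
      -- `|t| ≤ T - δ < T` and `ε/4 ≤ r ≤ 1 - ε/4`.
      · exfalso
        refine hp ⟨abs_lt.1 ?_, ?_, ?_⟩ <;> linarith
  · refine HasCompactSupport.of_support_subset_isCompact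
      (K := Icc (-T) T ×ˢ Metric.closedBall 0 1)
      (isCompact_Icc.prod (isCompact_closedBall 0 1)) fun p hp => ?_
    have : p ∈ puncturedCylinder n T := by
      by_contra h
      exact hp (by simp only [hG, if_neg h])
    exact ⟨Ioo_subset_Icc_self this.1, by simpa using this.2.2.le⟩
  · intro p hp hr
    simp only [hG, if_pos hp, hχe _ hr.1 hr.2, one_mul]

theorem norm_smul_sphere {E : Type*} [NormedAddCommGroup E] [NormedSpace ℝ E] {r : ℝ} (hr : 0 ≤ r)
    (θ : Metric.sphere (0 : E) 1) : ‖r • (θ : E)‖ = r := by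
  rw [norm_smul, Real.norm_of_nonneg hr]; simp

theorem lateralIntegral_congr {n : ℕ} {T r : ℝ} (hr : 0 ≤ r) {F G : Spacetime n → ℝ}
    (h : ∀ p : Spacetime n, p.1 ∈ Ioo (-T) T → ‖p.2‖ = r → F p = G p) :
    lateralIntegral T r F = lateralIntegral T r G := by
  refine setIntegral_congr_fun measurableSet_Ioo fun t ht => ?_
  congr 2
  funext θ
  exact h _ ht (norm_smul_sphere hr θ)

theorem integrable_comp_polar {n : ℕ} {F : Spacetime n → ℝ} (hF : Continuous F)
    (hc : HasCompactSupport F) (T r : ℝ) :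
    Integrable (Function.uncurry fun (t : ℝ) (θ : Metric.sphere (0 : EuclideanSpace ℝ (Fin n)) 1) =>
      F (t, r • (θ : EuclideanSpace ℝ (Fin n))))
      ((volume.restrict (Ioo (-T) T)).prod volume.toSphere) := by
  obtain ⟨C, hC⟩ := hc.exists_bound_of_continuous hF
  refine Integrable.of_bound (C := C) ?_ (Filter.Eventually.of_forall fun q => hC _)
  refine Continuous.aestronglyMeasurable ?_
  unfold Function.uncurry
  fun_prop

/-- Fubini: the two differ in the order of the time and angular integrations. -/
theorem lateralIntegral_eq_shellIntegral {n : ℕ} {T : ℝ} {F : Spacetime n → ℝ} (hF : Continuous F)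
    (hc : HasCompactSupport F) (hT : ∀ p : Spacetime n, p.1 ∉ Ioo (-T) T → F p = 0) (r : ℝ) :
    lateralIntegral T r F = shellIntegral F r := by
  unfold lateralIntegral shellIntegral
  rw [integral_const_mul, integral_integral_swap (integrable_comp_polar hF hc T r)]
  congr 2
  funext θ
  exact setIntegral_eq_integral_of_forall_compl_eq_zero fun t ht => hT _ ht

theorem setIntegral_cylinderEps {n : ℕ} (hn : 1 ≤ n) {T ε : ℝ} (hε : 0 < ε) (hε' : ε < 1 / 2)
    {F : Spacetime n → ℝ} (hF : Continuous F)
    (hc : HasCompactSupport F) (hT : ∀ p : Spacetime n, p.1 ∉ Ioo (-T) T → F p = 0) :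
    ∫ p in cylinderEps n T ε, F p = ∫ r in ε..(1 - ε), shellIntegral F r := by
  have hm := (isOpen_cylinderEps n T ε).measurableSet
  rw [← integral_indicator hm, integral_eq_integral_polar hn
    ((hF.integrable_of_hasCompactSupport hc).indicator hm),
    intervalIntegral.integral_of_le (by linarith), integral_Ioc_eq_integral_Ioo]
  have hsub : Ioo ε (1 - ε) ⊆ Ioi 0 := fun r hr => hε.trans hr.1
  refine (setIntegral_eq_of_subset_of_forall_sdiff_eq_zero measurableSet_Ioi hsub ?_).trans ?_
  rotate_left
  · refine setIntegral_congr_fun measurableSet_Ioo fun r hr => ?_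
    simp only [shellIntegral]
    congr 2
    funext θ
    congr 1
    funext t
    by_cases ht : t ∈ Ioo (-T) T
    · rw [indicator_of_mem]
      refine ⟨ht, ?_⟩
      rw [norm_smul_sphere (hsub hr).le]
      exact hr
    · rw [indicator_of_notMem (fun h => ht h.1), hT _ ht]
  · intro r hr
    have : ∀ (θ : Metric.sphere (0 : EuclideanSpace ℝ (Fin n)) 1) t,
        (cylinderEps n T ε).indicator F (t, r • (θ : EuclideanSpace ℝ (Fin n))) = 0 := fun θ t => by
      refine indicator_of_notMem (fun h => hr.2 ?_) _
      have h2 := h.2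
      rwa [norm_smul_sphere (le_of_lt hr.1)] at h2
    simp [this]

theorem Admissible.lateralIntegral_add {n : ℕ} {T δ : ℝ} (hδ : 0 < δ) {F G : Spacetime n → ℝ}
    (hF : Admissible T δ 0 F) (hG : Admissible T δ 0 G) {r : ℝ} (hr : r ∈ Ioo 0 1) :
    lateralIntegral T r (fun p => F p + G p) = lateralIntegral T r F + lateralIntegral T r G := by
  -- Any `ε` with `ε/2 < r < 1 - ε/2` would do: the shell must lie where the extension agrees with
  -- the function, so that integrability comes from compact support.
  set ε := min r (1 - r) with hε
  have hε0 : 0 < ε := lt_min hr.1 (by linarith [hr.2])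
  have h1 : ε / 2 < r := by linarith [min_le_left r (1 - r)]
  have h2 : r < 1 - ε / 2 := by linarith [min_le_right r (1 - r)]
  obtain ⟨F', hF', hFc, -, -, -, hFe⟩ := Admissible.exists_extension (k := 0) hδ hF hε0
  obtain ⟨G', hG', hGc, -, -, -, hGe⟩ := Admissible.exists_extension (k := 0) hδ hG hε0
  have eF : ∀ p : Spacetime n, p.1 ∈ Ioo (-T) T → ‖p.2‖ = r → F p = F' p := fun p ht hp =>
    (hFe p ⟨ht, by rwa [hp]⟩ (by rw [hp]; exact ⟨h1, h2⟩)).symm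
  have eG : ∀ p : Spacetime n, p.1 ∈ Ioo (-T) T → ‖p.2‖ = r → G p = G' p := fun p ht hp =>
    (hGe p ⟨ht, by rwa [hp]⟩ (by rw [hp]; exact ⟨h1, h2⟩)).symm
  rw [lateralIntegral_congr hr.1.le eF, lateralIntegral_congr hr.1.le eG,
    lateralIntegral_congr (G := fun p => F' p + G' p) hr.1.le fun p ht hp => by
      rw [eF p ht hp, eG p ht hp]]
  have iF := integrable_comp_polar hF'.continuous hFc T r
  have iG := integrable_comp_polar hG'.continuous hGc T r
  have e := integral_add iF iG
  rw [integral_prod _ iF, integral_prod _ iG] at e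
  replace e := (integral_prod _ (iF.add iG)).symm.trans e
  unfold lateralIntegral
  rw [integral_const_mul, integral_const_mul, integral_const_mul, ← mul_add]
  congr 1

theorem Admissible.integrableOn {n : ℕ} {T δ : ℝ} (hδ : 0 < δ) {F : Spacetime n → ℝ}
    (hF : Admissible T δ 0 F) {ε : ℝ} (hε : 0 < ε) : IntegrableOn F (cylinderEps n T ε) := by
  obtain ⟨F', hF', hFc, -, -, -, hFe⟩ := Admissible.exists_extension (k := 0) hδ hF hε
  refine (hF'.continuous.integrable_of_hasCompactSupport hFc).integrableOn.congr_fun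
    (fun p hp => hFe p (cylinderEps_subset hε hp) ?_) (isOpen_cylinderEps n T ε).measurableSet
  exact ⟨by linarith [hp.2.1], by linarith [hp.2.2]⟩

/-- There is no flux through the faces `t = ±T`, near which the field vanishes; only the two lateral
components contribute. -/
theorem setIntegral_divergence {n : ℕ} (hn : 1 ≤ n) {T δ : ℝ} (hδ : 0 < δ)
    {X : Fin (n + 1) → Spacetime n → ℝ} (hX : ∀ α, Admissible T δ 1 (X α))
    {ε : ℝ} (hε : 0 < ε) (hε' : ε < 1 / 2) :
    ∫ p in cylinderEps n T ε, divergence X p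
      = lateralIntegral T (1 - ε) (radialPart X) - lateralIntegral T ε (radialPart X) := by
  choose Y hY hYc hY0 hY1 hYt hYe using fun α =>
    Admissible.exists_extension (k := 1) hδ (hX α) hε
  have hYT : ∀ α, ∀ p : Spacetime n, p.1 ∉ Ioo (-T) T → Y α p = 0 := fun α p hp => by
    refine hYt α p ?_
    have : T ≤ |p.1| := by
      by_contra h
      exact hp (abs_lt.1 (not_le.1 h))
    linarith
  have hdT : ∀ p : Spacetime n, p.1 ∉ Ioo (-T) T → divergence Y p = 0 := fun p hp => by
    refine Finset.sum_eq_zero fun α _ => ?_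
    have ho : IsOpen {q : Spacetime n | T - δ < |q.1|} := isOpen_lt (by fun_prop) (by fun_prop)
    have hm : T - δ < |p.1| := by
      have : T ≤ |p.1| := by
        by_contra h
        exact hp (abs_lt.1 (not_le.1 h))
      linarith
    have : Y α =ᶠ[nhds p] fun _ => 0 := by
      filter_upwards [ho.mem_nhds hm] with q hq using hYt α q hq
    rw [this.fderiv_eq]; simp
  have hrT : ∀ p : Spacetime n, p.1 ∉ Ioo (-T) T → radialPart Y p = 0 := fun p hp =>
    Finset.sum_eq_zero fun i _ => by rw [hYT _ p hp, mul_zero]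
  have e1 : ∫ p in cylinderEps n T ε, divergence X p
      = ∫ p in cylinderEps n T ε, divergence Y p := by
    refine setIntegral_congr_fun (isOpen_cylinderEps n T ε).measurableSet fun p hp => ?_
    refine Finset.sum_congr rfl fun α _ => ?_
    have : X α =ᶠ[nhds p] Y α := by
      filter_upwards [(isOpen_cylinderEps n T ε).mem_nhds hp] with q hq
      refine (hYe α q (cylinderEps_subset hε hq) ?_).symm
      exact ⟨by linarith [hq.2.1], by linarith [hq.2.2]⟩
    rw [this.fderiv_eq]
  have e2 : ∀ r ∈ Ioo (ε / 2) (1 - ε / 2), lateralIntegral T r (radialPart X)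
      = shellIntegral (radialPart Y) r := fun r hr => by
    have hr0 : 0 < r := by linarith [hr.1]
    rw [← lateralIntegral_eq_shellIntegral (T := T)
      (continuous_radialPart (fun α => (hY α).continuous) (by linarith : 0 < ε / 4) hY0)
      (hasCompactSupport_radialPart hYc) hrT]
    refine lateralIntegral_congr hr0.le fun p ht hp => Finset.sum_congr rfl fun i _ => ?_
    rw [hYe i.succ p ⟨ht, by rw [hp]; exact ⟨hr0, by linarith [hr.2]⟩⟩ (by rwa [hp])]
  rw [e1, setIntegral_cylinderEps hn hε hε' (continuous_divergence hY)
    (hasCompactSupport_divergence hYc) hdT,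
    integral_shellIntegral_divergence_Ioo hn hY hYc (by linarith : 0 < ε / 4) hY0 hY1 hε
      (by linarith) (by linarith),
    e2 ε ⟨by linarith, by linarith⟩, e2 (1 - ε) ⟨by linarith, by linarith⟩]

/-! ### Partial derivatives and the multiplier identity -/

/-- The partial derivative along a vector of the Cartesian frame. -/
noncomputable def pd {n : ℕ} (α : Fin (n + 1)) (φ : Spacetime n → ℝ) (p : Spacetime n) : ℝ :=
  fderiv ℝ φ p (frame n α)

/-- The diagonal entries of the Minkowski metric. -/
def eta (n : ℕ) : Fin (n + 1) → ℝ := Fin.cons (-1) (fun _ => 1)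

@[simp] theorem eta_zero (n : ℕ) : eta n 0 = -1 := rfl
@[simp] theorem eta_succ (n : ℕ) (i : Fin n) : eta n i.succ = 1 := rfl

theorem sum_minkowski {n : ℕ} (A : Fin (n + 1) → Fin (n + 1) → ℝ) :
    ∑ α, ∑ β, minkowski n α β * A α β = ∑ α, eta n α * A α α := by
  refine Finset.sum_congr rfl fun α _ => ?_
  rw [Finset.sum_eq_single α]
  · simp [minkowski, eta]
  · intro β _ h
    simp [minkowski, Matrix.diagonal_apply_ne _ h.symm]
  · simp

theorem contract_eq {n : ℕ} (a b : Spacetime n →L[ℝ] ℝ) :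
    contract a b = ∑ α, eta n α * (a (frame n α) * b (frame n α)) := by
  rw [← sum_minkowski fun α β => a (frame n α) * b (frame n β)]
  simp [contract, mul_assoc]

section PartialDerivatives

variable {n : ℕ} {α : Fin (n + 1)} {p : Spacetime n} {a b : Spacetime n → ℝ}

theorem pd_mul (ha : DifferentiableAt ℝ a p) (hb : DifferentiableAt ℝ b p) :
    pd α (fun q => a q * b q) p = pd α a p * b p + a p * pd α b p := by
  simp only [pd, fderiv_fun_mul ha hb, add_apply,
    smul_apply, smul_eq_mul]
  ring

theorem pd_add (ha : DifferentiableAt ℝ a p) (hb : DifferentiableAt ℝ b p) :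
    pd α (fun q => a q + b q) p = pd α a p + pd α b p := by
  simp only [pd, fderiv_fun_add ha hb, add_apply]

theorem pd_const_mul (ha : DifferentiableAt ℝ a p) (c : ℝ) :
    pd α (fun q => c * a q) p = c * pd α a p := by
  simp only [pd, fderiv_const_mul ha, smul_apply, smul_eq_mul]

theorem pd_sum {ι : Type*} {s : Finset ι} {A : ι → Spacetime n → ℝ}
    (hA : ∀ i ∈ s, DifferentiableAt ℝ (A i) p) :
    pd α (fun q => ∑ i ∈ s, A i q) p = ∑ i ∈ s, pd α (A i) p := by
  simp only [pd, fderiv_fun_sum hA, sum_apply]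

theorem pd_congr (h : a =ᶠ[nhds p] b) : pd α a p = pd α b p := by
  simp only [pd, h.fderiv_eq]

end PartialDerivatives

/-- The energy current of the multiplier `∇f + w` for the equation `div (ρ ∇v) = F`, where `f'`, `w'`
and `v'` are the partial derivatives of `f`, `w` and `v`. -/
noncomputable def energyField {n : ℕ} (ρ : Spacetime n → ℝ) (f' : Fin (n + 1) → Spacetime n → ℝ)
    (w : Spacetime n → ℝ) (w' : Fin (n + 1) → Spacetime n → ℝ)
    (v : Spacetime n → ℝ) (v' : Fin (n + 1) → Spacetime n → ℝ)
    (α : Fin (n + 1)) (q : Spacetime n) : ℝ :=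
  eta n α * ((-1) * (ρ q * v' α q) * ((∑ β, eta n β * (f' β q * v' β q)) + w q * v q)
    + (1 / 2) * (ρ q * f' α q) * (∑ β, eta n β * (v' β q * v' β q))
    + (1 / 2) * (ρ q * w' α q) * (v q * v q))

/-- The product rule, in which all second derivatives of `v` outside `div(ρ∇v)` cancel: those from
differentiating `∇f·∇v` against those from `½ ∇f·∇(g(∇v, ∇v))`. The cross term `∇w·∇v v` cancels
likewise, thanks to the last summand of the current. -/
theorem divergence_energyField {n : ℕ} {ρ w v : Spacetime n → ℝ}
    {f' w' v' : Fin (n + 1) → Spacetime n → ℝ} {p : Spacetime n}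
    (hρ : DifferentiableAt ℝ ρ p) (hw : DifferentiableAt ℝ w p) (hv : DifferentiableAt ℝ v p)
    (hf' : ∀ α, DifferentiableAt ℝ (f' α) p) (hw' : ∀ α, DifferentiableAt ℝ (w' α) p)
    (hv' : ∀ α, DifferentiableAt ℝ (v' α) p)
    (hvp : ∀ α, pd α v p = v' α p) (hwp : ∀ α, pd α w p = w' α p)
    (hsymm : ∀ α β, pd α (v' β) p = pd β (v' α) p) :
    divergence (energyField ρ f' w w' v v') p
      = -(∑ α, eta n α * pd α (fun q => ρ q * v' α q) p)
          * ((∑ β, eta n β * (f' β p * v' β p)) + w p * v p)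
        - ρ p * (∑ α, ∑ β, eta n α * eta n β * (pd α (f' β) p * v' α p * v' β p))
        - ρ p * w p * (∑ β, eta n β * (v' β p * v' β p))
        + (1 / 2) * (∑ α, eta n α * pd α (fun q => ρ q * f' α q) p)
          * (∑ β, eta n β * (v' β p * v' β p))
        + (1 / 2) * (∑ α, eta n α * pd α (fun q => ρ q * w' α q) p) * (v p * v p) := by
  have hQ : ∀ α, pd α (fun q => ∑ β, eta n β * (f' β q * v' β q)) p
      = ∑ β, eta n β * (pd α (f' β) p * v' β p + f' β p * pd α (v' β) p) := fun α => by
    rw [pd_sum fun β _ => by have := hf' β; have := hv' β; fun_prop]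
    refine Finset.sum_congr rfl fun β _ => ?_
    rw [pd_const_mul (by have := hf' β; have := hv' β; fun_prop), pd_mul (hf' β) (hv' β)]
  have hN : ∀ α, pd α (fun q => ∑ β, eta n β * (v' β q * v' β q)) p
      = ∑ β, eta n β * (2 * (v' β p * pd α (v' β) p)) := fun α => by
    rw [pd_sum fun β _ => by have := hv' β; fun_prop]
    refine Finset.sum_congr rfl fun β _ => ?_
    rw [pd_const_mul (by have := hv' β; fun_prop), pd_mul (hv' β) (hv' β)]
    ring
  have hdQ : DifferentiableAt ℝ (fun q => ∑ β, eta n β * (f' β q * v' β q)) p :=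
    DifferentiableAt.fun_sum fun β _ => by have := hf' β; have := hv' β; fun_prop
  have hdN : DifferentiableAt ℝ (fun q => ∑ β, eta n β * (v' β q * v' β q)) p :=
    DifferentiableAt.fun_sum fun β _ => by have := hv' β; fun_prop
  have main : ∀ α, pd α (energyField ρ f' w w' v v' α) p
      = -(eta n α * pd α (fun q => ρ q * v' α q) p)
          * ((∑ β, eta n β * (f' β p * v' β p)) + w p * v p)
        - ρ p * (∑ β, eta n α * eta n β * (pd α (f' β) p * v' α p * v' β p))
        - ρ p * (∑ β, eta n α * eta n β * (f' β p * v' α p * pd α (v' β) p))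
        + ρ p * (∑ β, eta n α * eta n β * (f' α p * v' β p * pd α (v' β) p))
        - ρ p * w p * (eta n α * (v' α p * v' α p))
        + (1 / 2) * (eta n α * pd α (fun q => ρ q * f' α q) p)
          * (∑ β, eta n β * (v' β p * v' β p))
        + (1 / 2) * (eta n α * pd α (fun q => ρ q * w' α q) p) * (v p * v p) := fun α => by
    have h1 := hf' α
    have h2 := hw' α
    have h3 := hv' α
    unfold energyField
    rw [pd_const_mul (by fun_prop), pd_add (by fun_prop) (by fun_prop),
      pd_add (by fun_prop) (by fun_prop), pd_mul (by fun_prop) (by fun_prop),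
      pd_mul (by fun_prop) hdN, pd_mul (b := fun q => v q * v q) (by fun_prop) (by fun_prop), pd_mul hv hv,
      pd_add hdQ (by fun_prop), pd_mul hw hv, pd_const_mul (by fun_prop),
      pd_const_mul (by fun_prop), pd_const_mul (by fun_prop), hQ, hN, hvp, hwp]
    have e1 : ∑ β, eta n β * (pd α (f' β) p * v' β p + f' β p * pd α (v' β) p)
        = ∑ β, eta n β * (pd α (f' β) p * v' β p) + ∑ β, eta n β * (f' β p * pd α (v' β) p) := by
      rw [← Finset.sum_add_distrib]
      exact Finset.sum_congr rfl fun β _ => by ring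
    have e2 : ∑ β, eta n α * eta n β * (pd α (f' β) p * v' α p * v' β p)
        = eta n α * v' α p * ∑ β, eta n β * (pd α (f' β) p * v' β p) := by
      rw [Finset.mul_sum]
      exact Finset.sum_congr rfl fun β _ => by ring
    have e3 : ∑ β, eta n α * eta n β * (f' β p * v' α p * pd α (v' β) p)
        = eta n α * v' α p * ∑ β, eta n β * (f' β p * pd α (v' β) p) := by
      rw [Finset.mul_sum]
      exact Finset.sum_congr rfl fun β _ => by ring
    have e4 : ∑ β, eta n α * eta n β * (f' α p * v' β p * pd α (v' β) p)
        = eta n α * f' α p * (1 / 2) * ∑ β, eta n β * (2 * (v' β p * pd α (v' β) p)) := by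
      rw [Finset.mul_sum]
      exact Finset.sum_congr rfl fun β _ => by ring
    rw [e1, e2, e3, e4]
    ring
  -- This is where the symmetry of the Hessian of `v` enters.
  have hcross : ∑ α, ∑ β, eta n α * eta n β * (f' β p * v' α p * pd α (v' β) p)
      = ∑ α, ∑ β, eta n α * eta n β * (f' α p * v' β p * pd α (v' β) p) := by
    rw [Finset.sum_comm]
    refine Finset.sum_congr rfl fun β _ => Finset.sum_congr rfl fun α _ => ?_
    rw [hsymm]
    ring
  have : divergence (energyField ρ f' w w' v v') p
      = ∑ α, pd α (energyField ρ f' w w' v v' α) p := rfl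
  rw [this, Finset.sum_congr rfl fun α _ => main α]
  simp only [Finset.sum_add_distrib, Finset.sum_sub_distrib, ← Finset.mul_sum, ← Finset.sum_mul,
    Finset.sum_neg_distrib, hcross]
  ring

/-! ### Radial fields and the radial profiles of `f`, `w` and the Hardy correction -/

/-- The components of the spatial vector field `G(r) x`. -/
noncomputable def radialField {n : ℕ} (G : ℝ → ℝ) : Fin (n + 1) → Spacetime n → ℝ :=
  Fin.cons (fun _ => 0) fun i q => G ‖q.2‖ * q.2 i

theorem differentiableAt_comp_norm {n : ℕ} {G : ℝ → ℝ} {G' : ℝ} {p : Spacetime n} (hp : p.2 ≠ 0)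
    (hG : HasDerivAt G G' ‖p.2‖) : DifferentiableAt ℝ (fun q : Spacetime n => G ‖q.2‖) p :=
  (hasFDerivAt_comp_norm hp hG).differentiableAt

theorem differentiableAt_coord {n : ℕ} (p : Spacetime n) (i : Fin n) :
    DifferentiableAt ℝ (fun q : Spacetime n => q.2 i) p := by fun_prop

theorem pd_succ_coord {n : ℕ} (p : Spacetime n) (i j : Fin n) :
    pd j.succ (fun q : Spacetime n => q.2 i) p = if i = j then 1 else 0 := by
  have h : HasFDerivAt (fun q : Spacetime n => q.2 i)
      ((EuclideanSpace.proj (𝕜 := ℝ) i).comp (ContinuousLinearMap.snd ℝ ℝ _)) p :=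
    ((EuclideanSpace.proj (𝕜 := ℝ) i).comp
      (ContinuousLinearMap.snd ℝ ℝ (EuclideanSpace ℝ (Fin n)))).hasFDerivAt
  simp [pd, h.fderiv, frame]

theorem pd_zero_coord {n : ℕ} (p : Spacetime n) (i : Fin n) :
    pd 0 (fun q : Spacetime n => q.2 i) p = 0 := by
  have h : HasFDerivAt (fun q : Spacetime n => q.2 i)
      ((EuclideanSpace.proj (𝕜 := ℝ) i).comp (ContinuousLinearMap.snd ℝ ℝ _)) p :=
    ((EuclideanSpace.proj (𝕜 := ℝ) i).comp
      (ContinuousLinearMap.snd ℝ ℝ (EuclideanSpace ℝ (Fin n)))).hasFDerivAt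
  simp [pd, h.fderiv, frame]

theorem pd_succ_radial {n : ℕ} {G : ℝ → ℝ} {G' : ℝ} {p : Spacetime n} (hp : p.2 ≠ 0)
    (hG : HasDerivAt G G' ‖p.2‖) (i j : Fin n) :
    pd j.succ (fun q : Spacetime n => G ‖q.2‖ * q.2 i) p
      = G' * ‖p.2‖⁻¹ * (p.2 i * p.2 j) + if i = j then G ‖p.2‖ else 0 := by
  rw [pd_mul (differentiableAt_comp_norm hp hG) (differentiableAt_coord p i), pd_succ_coord, pd,
    fderiv_comp_norm_frame_succ hp hG]
  split_ifs <;> ring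

theorem pd_zero_radial {n : ℕ} {G : ℝ → ℝ} {G' : ℝ} {p : Spacetime n} (hp : p.2 ≠ 0)
    (hG : HasDerivAt G G' ‖p.2‖) (i : Fin n) :
    pd 0 (fun q : Spacetime n => G ‖q.2‖ * q.2 i) p = 0 := by
  rw [pd_mul (differentiableAt_comp_norm hp hG) (differentiableAt_coord p i), pd_zero_coord, pd,
    fderiv_comp_norm_frame_zero hp hG]
  simp

theorem sum_sq_eq_norm_sq {n : ℕ} (x : EuclideanSpace ℝ (Fin n)) : ∑ i, x i * x i = ‖x‖ ^ 2 := by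
  rw [EuclideanSpace.norm_sq_eq]
  exact Finset.sum_congr rfl fun i _ => by rw [Real.norm_eq_abs, sq_abs, sq]

/-- The spatial divergence of the vector field `G(r) x`. -/
theorem sum_pd_radial {n : ℕ} {G : ℝ → ℝ} {G' : ℝ} {p : Spacetime n} (hp : p.2 ≠ 0)
    (hG : HasDerivAt G G' ‖p.2‖) :
    ∑ i : Fin n, pd i.succ (fun q : Spacetime n => G ‖q.2‖ * q.2 i) p
      = G' * ‖p.2‖ + n * G ‖p.2‖ := by
  have h : ‖p.2‖ ≠ 0 := norm_ne_zero_iff.2 hp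
  simp only [pd_succ_radial hp hG, if_true, Finset.sum_add_distrib, ← Finset.mul_sum,
    sum_sq_eq_norm_sq]
  simp
  field_simp

/-- The weight `y^{2κ}` as a function of the radius. -/
noncomputable def weight (κ r : ℝ) : ℝ := (1 - r) ^ (2 * κ)

theorem hasDerivAt_one_sub_rpow (a : ℝ) {r : ℝ} (hr : r < 1) :
    HasDerivAt (fun s : ℝ => (1 - s) ^ a) (-(a * (1 - r) ^ (a - 1))) r := by
  have h := ((hasDerivAt_id r).const_sub 1).rpow_const (p := a) (Or.inl (by simp; linarith))
  refine h.congr_deriv ?_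
  simp

theorem hasDerivAt_weight (κ : ℝ) {r : ℝ} (hr : r < 1) :
    HasDerivAt (weight κ) (-(2 * κ) * weight κ r / (1 - r)) r := by
  refine (hasDerivAt_one_sub_rpow (2 * κ) hr).congr_deriv ?_
  rw [Real.rpow_sub_one (by linarith), weight]
  ring

theorem weight_pos (κ : ℝ) {r : ℝ} (hr : r < 1) : 0 < weight κ r :=
  Real.rpow_pos_of_pos (by linarith) _

/-- The radial derivative of `f`, divided by the radius. -/
noncomputable def gradProfile (κ r : ℝ) : ℝ := weight κ r / r

/-- The function `w_{f,z}` in terms of the radius. -/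
noncomputable def wProfile (n : ℕ) (κ c r : ℝ) : ℝ :=
  -3 * c - 2 * κ * (weight κ r / (1 - r)) + ((n : ℝ) - 1) / 2 * (weight κ r / r)

/-- The radial derivative of `w_{f,z}`. -/
noncomputable def wProfileDeriv (n : ℕ) (κ r : ℝ) : ℝ :=
  2 * κ * (2 * κ - 1) * (weight κ r / (1 - r) ^ 2)
    - ((n : ℝ) - 1) * κ * (weight κ r / ((1 - r) * r)) - ((n : ℝ) - 1) / 2 * (weight κ r / r ^ 2)

/-- The profile of the correction coming from the Hardy inequality. -/
noncomputable def hardyProfile (κ r : ℝ) : ℝ :=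
  2 * κ * (1 - 2 * κ) * (weight κ r * weight κ r / ((1 - r) ^ 2 * r))

section Profiles

variable {n : ℕ} {κ c r : ℝ}

theorem hasDerivAt_gradProfile (h0 : 0 < r) (h1 : r < 1) :
    HasDerivAt (gradProfile κ)
      (-(2 * κ) * weight κ r / ((1 - r) * r) - weight κ r / r ^ 2) r := by
  have hy : (1 - r) ≠ 0 := by linarith
  refine ((hasDerivAt_weight κ h1).div (hasDerivAt_id r) h0.ne').congr_deriv ?_
  simp only [id]
  field_simp

theorem hasDerivAt_wProfile (h0 : 0 < r) (h1 : r < 1) :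
    HasDerivAt (wProfile n κ c) (wProfileDeriv n κ r) r := by
  have hy : (1 - r) ≠ 0 := by linarith
  have hw := hasDerivAt_weight κ h1
  have d1 := (hw.div ((hasDerivAt_id r).const_sub 1) hy).const_mul (2 * κ)
  have d2 := (hw.div (hasDerivAt_id r) h0.ne').const_mul (((n : ℝ) - 1) / 2)
  refine (((hasDerivAt_const r (-3 * c)).sub d1).add d2).congr_deriv ?_
  simp only [id, wProfileDeriv]
  field_simp
  ring

theorem hasDerivAt_weight_mul_gradProfile (h0 : 0 < r) (h1 : r < 1) :
    HasDerivAt (fun s => weight κ s * gradProfile κ s)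
      (-(4 * κ) * (weight κ r * weight κ r) / ((1 - r) * r)
        - weight κ r * weight κ r / r ^ 2) r := by
  have hy : (1 - r) ≠ 0 := by linarith
  refine ((hasDerivAt_weight κ h1).mul (hasDerivAt_gradProfile h0 h1)).congr_deriv ?_
  simp only [gradProfile]
  field_simp
  ring

theorem hasDerivAt_wProfileDeriv (h0 : 0 < r) (h1 : r < 1) :
    HasDerivAt (wProfileDeriv n κ)
      (-(2 * κ * (2 * κ - 1) * (2 * κ - 2)) * (weight κ r / (1 - r) ^ 3)
        + ((n : ℝ) - 1) * κ * (2 * κ - 1) * (weight κ r / ((1 - r) ^ 2 * r))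
        + 2 * ((n : ℝ) - 1) * κ * (weight κ r / ((1 - r) * r ^ 2))
        + ((n : ℝ) - 1) * (weight κ r / r ^ 3)) r := by
  have hy : (1 - r) ≠ 0 := by linarith
  have hw := hasDerivAt_weight κ h1
  have hs := (hasDerivAt_id r).const_sub 1
  have d1 := (hw.div (hs.pow 2) (pow_ne_zero 2 hy)).const_mul (2 * κ * (2 * κ - 1))
  have d2 := (hw.div (hs.mul (hasDerivAt_id r)) (mul_ne_zero hy h0.ne')).const_mul
    (((n : ℝ) - 1) * κ)
  have d3 := (hw.div ((hasDerivAt_id r).pow 2) (pow_ne_zero 2 h0.ne')).const_mul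
    (((n : ℝ) - 1) / 2)
  refine ((d1.sub d2).sub d3).congr_deriv ?_
  simp
  field_simp
  ring

/-- For `G = ρ w'/r`, the divergence of the field `G(r) x` is `r G' + n G`. Only this combination is
needed, so the derivative itself stays existential. -/
theorem hasDerivAt_weight_mul_wProfileDeriv (h0 : 0 < r) (h1 : r < 1) :
    ∃ C', HasDerivAt (fun s => weight κ s * (wProfileDeriv n κ s / s)) C' r ∧
      C' * r + n * (weight κ r * (wProfileDeriv n κ r / r))
        = weight κ r * (-(4 * κ * (2 * κ - 1) ^ 2) * (weight κ r / (1 - r) ^ 3)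
          + ((n : ℝ) - 1) * κ * (8 * κ - 3) * (weight κ r / ((1 - r) ^ 2 * r))
          + (4 - (n : ℝ)) * ((n : ℝ) - 1) * κ * (weight κ r / ((1 - r) * r ^ 2))
          + ((n : ℝ) - 1) * (3 - (n : ℝ)) / 2 * (weight κ r / r ^ 3)) := by
  have hy : (1 - r) ≠ 0 := by linarith
  refine ⟨_, (hasDerivAt_weight κ h1).mul
    ((hasDerivAt_wProfileDeriv h0 h1).div (hasDerivAt_id r) h0.ne'), ?_⟩
  simp only [wProfileDeriv]
  -- The identity holds with `r` and `y` as independent variables.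
  generalize hyy : 1 - r = y at *
  field_simp
  ring

theorem hasDerivAt_hardyProfile (h0 : 0 < r) (h1 : r < 1) :
    HasDerivAt (hardyProfile κ)
      (2 * κ * (1 - 2 * κ) * (-(4 * κ - 2) * (weight κ r * weight κ r / ((1 - r) ^ 3 * r))
        - weight κ r * weight κ r / ((1 - r) ^ 2 * r ^ 2))) r := by
  have hy : (1 - r) ≠ 0 := by linarith
  have hw := hasDerivAt_weight κ h1
  have hs := (hasDerivAt_id r).const_sub 1
  refine (((hw.mul hw).div ((hs.pow 2).mul (hasDerivAt_id r))
    (mul_ne_zero (pow_ne_zero 2 hy) h0.ne')).const_mul (2 * κ * (1 - 2 * κ))).congr_deriv ?_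
  simp
  left
  field_simp
  ring

end Profiles

/-! ### The functions `f`, `w` and `y` on the punctured cylinder -/

/-- The partial derivatives of `f`. -/
noncomputable def fGrad {n : ℕ} (κ c : ℝ) : Fin (n + 1) → Spacetime n → ℝ :=
  Fin.cons (fun q => -2 * c * q.1) fun i q => gradProfile κ ‖q.2‖ * q.2 i

/-- The partial derivatives of `w_{f,z}`. -/
noncomputable def wGrad {n : ℕ} (κ : ℝ) : Fin (n + 1) → Spacetime n → ℝ :=
  radialField fun r => wProfileDeriv n κ r / r

/-- The untwisted function `v = y^{-κ} u`. -/
noncomputable def untwist {n : ℕ} (κ : ℝ) (u : Spacetime n → ℝ) (q : Spacetime n) : ℝ :=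
  yFun q ^ (-κ) * u q

section Region

variable {n : ℕ} {T κ c : ℝ} {p : Spacetime n}

theorem pd_time_sq (α : Fin (n + 1)) (p : Spacetime n) :
    pd α (fun q : Spacetime n => q.1 ^ 2) p = 2 * p.1 * (frame n α).1 := by
  have h : HasFDerivAt (fun q : Spacetime n => q.1) (ContinuousLinearMap.fst ℝ ℝ _) p :=
    hasFDerivAt_fst
  rw [pd, (h.pow 2).fderiv]
  simp

theorem pd_time (α : Fin (n + 1)) (p : Spacetime n) :
    pd α (fun q : Spacetime n => q.1) p = (frame n α).1 := by
  have h : HasFDerivAt (fun q : Spacetime n => q.1) (ContinuousLinearMap.fst ℝ ℝ _) p :=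
    hasFDerivAt_fst
  rw [pd, h.fderiv]
  simp

theorem pd_fFun (hκ : -(1 / 2) < κ) (hp : p ∈ puncturedCylinder n T) (α : Fin (n + 1)) :
    pd α (fFun κ c) p = fGrad κ c α p := by
  have hp2 : p.2 ≠ 0 := norm_pos_iff.1 hp.2.1
  have hne : 1 + 2 * κ ≠ 0 := by linarith
  have hd : HasDerivAt (fun r : ℝ => -(1 / (1 + 2 * κ)) * (1 - r) ^ (1 + 2 * κ))
      (weight κ ‖p.2‖) ‖p.2‖ := by
    refine ((hasDerivAt_one_sub_rpow (1 + 2 * κ) hp.2.2).const_mul _).congr_deriv ?_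
    rw [weight, show 1 + 2 * κ - 1 = 2 * κ by ring]
    field_simp
  have e : fFun κ c = fun q : Spacetime n =>
      (fun r : ℝ => -(1 / (1 + 2 * κ)) * (1 - r) ^ (1 + 2 * κ)) ‖q.2‖ + -c * q.1 ^ 2 := by
    funext q
    simp only [fFun, yFun]
    ring
  rw [e, pd_add (differentiableAt_comp_norm hp2 hd) (by fun_prop),
    pd_const_mul (a := fun q => q.1 ^ 2) (by fun_prop),
    pd_time_sq]
  refine Fin.cases ?_ (fun i => ?_) α
  · rw [pd, fderiv_comp_norm_frame_zero hp2 hd]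
    simp [fGrad, frame]
    ring
  · rw [pd, fderiv_comp_norm_frame_succ hp2 hd]
    simp [fGrad, frame, gradProfile]
    ring

theorem pd_congr_of_eqOn {a b : Spacetime n → ℝ} (h : EqOn a b (puncturedCylinder n T))
    (hp : p ∈ puncturedCylinder n T) (α : Fin (n + 1)) : pd α a p = pd α b p :=
  pd_congr (Filter.eventuallyEq_of_mem ((isOpen_puncturedCylinder n T).mem_nhds hp) h)

theorem pd_yFun_zero (hp : p ∈ puncturedCylinder n T) : pd 0 (yFun (n := n)) p = 0 :=
  fderiv_comp_norm_frame_zero (G := fun r => 1 - r) (norm_pos_iff.1 hp.2.1)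
    ((hasDerivAt_id _).const_sub 1)

theorem pd_yFun_succ (hp : p ∈ puncturedCylinder n T) (i : Fin n) :
    pd i.succ (yFun (n := n)) p = -1 * (‖p.2‖⁻¹ * p.2 i) :=
  fderiv_comp_norm_frame_succ (G := fun r => 1 - r) (norm_pos_iff.1 hp.2.1)
    ((hasDerivAt_id _).const_sub 1) i

theorem sum_eta (A : Fin (n + 1) → ℝ) : ∑ α, eta n α * A α = -A 0 + ∑ i : Fin n, A i.succ := by
  rw [Fin.sum_univ_succ]
  simp

theorem pd_zero_time_mul (G : ℝ → ℝ) {G' : ℝ} (hp : p.2 ≠ 0) (hG : HasDerivAt G G' ‖p.2‖) (b : ℝ) :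
    pd 0 (fun q : Spacetime n => G ‖q.2‖ * (b * q.1)) p = b * G ‖p.2‖ := by
  rw [pd_mul (differentiableAt_comp_norm hp hG) (by fun_prop), pd_const_mul (by fun_prop), pd_time,
    pd, fderiv_comp_norm_frame_zero hp hG]
  simp [frame]
  ring

theorem waveOp_fFun (hκ : -(1 / 2) < κ) (hp : p ∈ puncturedCylinder n T) :
    waveOp (fFun κ c) p = 2 * c - 2 * κ * (weight κ ‖p.2‖ / (1 - ‖p.2‖))
      + ((n : ℝ) - 1) * (weight κ ‖p.2‖ / ‖p.2‖) := by
  have hp2 : p.2 ≠ 0 := norm_pos_iff.1 hp.2.1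
  have hr : ‖p.2‖ ≠ 0 := hp.2.1.ne'
  have hy : 1 - ‖p.2‖ ≠ 0 := by have := hp.2.2; linarith
  have e : waveOp (fFun κ c) p
      = ∑ α, eta n α * pd α (fun q => pd α (fFun κ c) q) p :=
    sum_minkowski fun α β => pd α (fun q => pd β (fFun κ c) q) p
  rw [e, Finset.sum_congr rfl fun α _ => by
    rw [pd_congr_of_eqOn (b := fGrad κ c α) (fun q hq => pd_fFun hκ hq α) hp], sum_eta]
  simp only [fGrad, Fin.cons_zero, Fin.cons_succ]
  rw [sum_pd_radial hp2 (hasDerivAt_gradProfile hp.2.1 hp.2.2), pd_const_mul (by fun_prop), pd_time]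
  simp only [frame, Fin.cons_zero, gradProfile]
  field_simp
  ring

theorem contract_yFun_fFun (hκ : -(1 / 2) < κ) (hp : p ∈ puncturedCylinder n T) :
    contract (fderiv ℝ yFun p) (fderiv ℝ (fFun κ c) p) = -weight κ ‖p.2‖ := by
  have hr : ‖p.2‖ ≠ 0 := hp.2.1.ne'
  have e : contract (fderiv ℝ yFun p) (fderiv ℝ (fFun κ c) p)
      = ∑ α, eta n α * (pd α yFun p * pd α (fFun κ c) p) := contract_eq _ _
  rw [e, sum_eta, pd_yFun_zero hp]
  simp only [pd_yFun_succ hp, pd_fFun hκ hp, fGrad, Fin.cons_succ]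
  have : ∀ i : Fin n, -1 * (‖p.2‖⁻¹ * p.2 i) * (gradProfile κ ‖p.2‖ * p.2 i)
      = -(gradProfile κ ‖p.2‖ * ‖p.2‖⁻¹) * (p.2 i * p.2 i) := fun i => by ring
  simp only [this, ← Finset.mul_sum, sum_sq_eq_norm_sq]
  rw [gradProfile]
  field_simp
  ring

theorem wFun_eq (hκ : -(1 / 2) < κ) (hp : p ∈ puncturedCylinder n T) :
    wFun κ (fFun κ c) (zFun c) p = wProfile n κ c ‖p.2‖ := by
  have hr : ‖p.2‖ ≠ 0 := hp.2.1.ne'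
  have hy : 1 - ‖p.2‖ ≠ 0 := by have := hp.2.2; linarith
  rw [wFun, waveOp_fFun hκ hp, contract_yFun_fFun hκ hp, zFun, yFun, wProfile]
  field_simp
  ring

theorem pd_wProfile (hp : p ∈ puncturedCylinder n T) (α : Fin (n + 1)) :
    pd α (fun q : Spacetime n => wProfile n κ c ‖q.2‖) p = wGrad κ α p := by
  have hp2 : p.2 ≠ 0 := norm_pos_iff.1 hp.2.1
  have hd := hasDerivAt_wProfile (n := n) (κ := κ) (c := c) hp.2.1 hp.2.2
  refine Fin.cases ?_ (fun i => ?_) α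
  · rw [pd, fderiv_comp_norm_frame_zero hp2 hd]
    simp [wGrad, radialField]
  · rw [pd, fderiv_comp_norm_frame_succ hp2 hd]
    simp only [wGrad, radialField, Fin.cons_succ]
    ring

theorem clm_radial (L : Spacetime n →L[ℝ] ℝ) (p : Spacetime n) :
    L (radial p) = ∑ i : Fin n, ‖p.2‖⁻¹ * p.2 i * L (frame n i.succ) := by
  have : radial p = ∑ i : Fin n, (‖p.2‖⁻¹ * p.2 i) • frame n i.succ := by
    simp only [frame, Fin.cons_succ]
    refine Prod.ext ?_ ?_
    · simp [radial, Prod.fst_sum]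
    · ext j
      simp [radial, Prod.snd_sum, Pi.single_apply]
  rw [this, map_sum]
  simp

end Region

/-! ### The Carleman field and the pointwise estimate -/

/-- The vector field whose divergence is controlled in the Carleman estimate. -/
noncomputable def carlemanField {n : ℕ} (κ c : ℝ) (u : Spacetime n → ℝ) (α : Fin (n + 1))
    (q : Spacetime n) : ℝ :=
  energyField (fun q => weight κ ‖q.2‖) (fGrad κ c) (fun q => wProfile n κ c ‖q.2‖) (wGrad κ)
      (untwist κ u) (fun β => pd β (untwist κ u)) α q
    + radialField (hardyProfile κ) α q * (untwist κ u q * untwist κ u q)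

section Pointwise

variable {n : ℕ} {T κ c : ℝ} {p : Spacetime n} {u : Spacetime n → ℝ}

theorem contDiffOn_comp_norm {k : WithTop ℕ∞} {G : ℝ → ℝ} (hG : ContDiffOn ℝ k G (Ioo 0 1)) :
    ContDiffOn ℝ k (fun q : Spacetime n => G ‖q.2‖) (puncturedCylinder n T) := fun q hq =>
  ((hG.contDiffAt (isOpen_Ioo.mem_nhds hq.2)).comp q
    (contDiffAt_snd.norm ℝ (norm_pos_iff.1 hq.2.1))).contDiffWithinAt

theorem contDiffOn_yFun_rpow (a : ℝ) {k : WithTop ℕ∞} :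
    ContDiffOn ℝ k (fun q : Spacetime n => yFun q ^ a) (puncturedCylinder n T) :=
  contDiffOn_comp_norm (G := fun r => (1 - r) ^ a)
    (ContDiffOn.rpow_const_of_ne (by fun_prop) fun r hr => by have := hr.2; linarith)

theorem contDiffOn_untwist (hu : ContDiffOn ℝ ∞ u (puncturedCylinder n T)) :
    ContDiffOn ℝ ∞ (untwist κ u) (puncturedCylinder n T) :=
  (contDiffOn_yFun_rpow (-κ)).mul hu

theorem contDiffOn_pd {v : Spacetime n → ℝ} (hv : ContDiffOn ℝ ∞ v (puncturedCylinder n T))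
    (α : Fin (n + 1)) : ContDiffOn ℝ ∞ (pd α v) (puncturedCylinder n T) :=
  (hv.fderiv_of_isOpen (isOpen_puncturedCylinder n T) (by simp)).clm_apply contDiffOn_const

theorem pd_comm {v : Spacetime n → ℝ} (hv : ContDiffOn ℝ ∞ v (puncturedCylinder n T))
    (hp : p ∈ puncturedCylinder n T) (α β : Fin (n + 1)) :
    pd α (pd β v) p = pd β (pd α v) p := by
  have hd : DifferentiableAt ℝ (fderiv ℝ v) p :=
    ((hv.fderiv_of_isOpen (isOpen_puncturedCylinder n T) (m := ∞) (by simp)).differentiableOn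
      (by simp)).differentiableAt ((isOpen_puncturedCylinder n T).mem_nhds hp)
  have h : ∀ α β, pd α (pd β v) p = fderiv ℝ (fderiv ℝ v) p (frame n α) (frame n β) :=
    fun α β => by
      have : HasFDerivAt (pd β v) _ p :=
        hd.hasFDerivAt.clm_apply (hasFDerivAt_const (frame n β) p)
      rw [pd, this.fderiv]
      simp
  rw [h, h]
  have hc := hv.contDiffAt ((isOpen_puncturedCylinder n T).mem_nhds hp)
  exact (hc.isSymmSndFDerivAt (by simpa using ENat.LEInfty.out)) _ _

theorem twistedD_eq (κ : ℝ) (u : Spacetime n → ℝ) (p X : Spacetime n) :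
    twistedD κ u p X = yFun p ^ κ * fderiv ℝ (untwist κ u) p X := rfl

theorem yFun_pos (hp : p ∈ puncturedCylinder n T) : 0 < yFun p := sub_pos.2 hp.2.2

theorem yFun_rpow_sq (hp : p ∈ puncturedCylinder n T) :
    yFun p ^ κ * yFun p ^ κ = weight κ ‖p.2‖ := by
  rw [← Real.rpow_add (yFun_pos hp), weight, ← two_mul]
  rfl

theorem eq_untwist (hp : p ∈ puncturedCylinder n T) : u p = yFun p ^ κ * untwist κ u p := by
  rw [untwist, ← mul_assoc, ← Real.rpow_add (yFun_pos hp)]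
  simp

/-- The inner factors `y^κ` of `D̄` and `D` combine into the weight `y^{2κ}`, leaving a
divergence-form operator acting on `v = y^{-κ} u`. -/
theorem twistedWaveOp_eq (hp : p ∈ puncturedCylinder n T) :
    twistedWaveOp κ u p = yFun p ^ (-κ) *
      ∑ α, eta n α * pd α (fun q => weight κ ‖q.2‖ * pd α (untwist κ u) q) p := by
  have e : twistedWaveOp κ u p = ∑ α, eta n α *
      (yFun p ^ (-κ) * pd α (fun q => yFun q ^ κ * (yFun q ^ κ * pd α (untwist κ u) q)) p) :=
    sum_minkowski fun α β =>
      yFun p ^ (-κ) * pd α (fun q => yFun q ^ κ * (yFun q ^ κ * pd β (untwist κ u) q)) p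
  rw [e, Finset.mul_sum]
  refine Finset.sum_congr rfl fun α _ => ?_
  rw [pd_congr_of_eqOn (b := fun q => weight κ ‖q.2‖ * pd α (untwist κ u) q) (fun q hq => by
    simp only [← yFun_rpow_sq hq, mul_assoc]) hp]
  ring

theorem multiplier_eq (hκ : -(1 / 2) < κ) (hp : p ∈ puncturedCylinder n T) :
    multiplier κ (fFun κ c) (zFun c) u p = yFun p ^ κ *
      ((∑ β, eta n β * (fGrad κ c β p * pd β (untwist κ u) p))
        + wProfile n κ c ‖p.2‖ * untwist κ u p) := by
  have e : contract (fderiv ℝ (fFun κ c) p) (twistedD κ u p)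
      = ∑ β, eta n β * (pd β (fFun κ c) p * (yFun p ^ κ * pd β (untwist κ u) p)) := contract_eq _ _
  rw [multiplier, e, wFun_eq hκ hp, eq_untwist (κ := κ) (u := u) hp, mul_add, Finset.mul_sum]
  congr 1
  · refine Finset.sum_congr rfl fun β _ => ?_
    rw [pd_fFun hκ hp]
    ring
  · ring

theorem sum_radial_eq (v' : Fin (n + 1) → ℝ) (p : Spacetime n) :
    ∑ i : Fin n, ‖p.2‖⁻¹ * p.2 i * v' i.succ = ‖p.2‖⁻¹ * ∑ i : Fin n, p.2 i * v' i.succ := by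
  rw [Finset.mul_sum]
  exact Finset.sum_congr rfl fun i _ => by ring

/-- Pythagoras, after the projection has killed the component along `x`. -/
theorem norm_sq_starProjection_orthogonal_singleton {E : Type*} [NormedAddCommGroup E]
    [InnerProductSpace ℝ E] {x : E} (hx : x ≠ 0) (V : E) (a b : ℝ) :
    ‖(ℝ ∙ x)ᗮ.starProjection (a • V + b • x)‖ ^ 2
      = a ^ 2 * (‖V‖ ^ 2 - (‖x‖⁻¹ * inner ℝ x V) ^ 2) := by
  have h0 : (ℝ ∙ x)ᗮ.starProjection x = 0 := by
    rw [Submodule.starProjection_orthogonal_val,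
      Submodule.starProjection_eq_self_iff.2 (Submodule.mem_span_singleton_self x), sub_self]
  have hr : ‖x‖ ≠ 0 := norm_ne_zero_iff.2 hx
  have h1 := Submodule.norm_sq_eq_add_norm_sq_starProjection V (ℝ ∙ x)
  have h2 : ‖(ℝ ∙ x).starProjection V‖ ^ 2 = (‖x‖⁻¹ * inner ℝ x V) ^ 2 := by
    rw [Submodule.starProjection_singleton, norm_smul, mul_pow, Real.norm_eq_abs, sq_abs]
    simp
    field_simp
  rw [map_add, map_smul, map_smul, h0, smul_zero, add_zero, norm_smul, mul_pow, Real.norm_eq_abs,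
    sq_abs]
  linarith [congrArg (a ^ 2 * ·) (show ‖(ℝ ∙ x)ᗮ.starProjection V‖ ^ 2
    = ‖V‖ ^ 2 - (‖x‖⁻¹ * inner ℝ x V) ^ 2 by linarith)]

/-- Since `y` is radial, the gradients of `u` and of `v` multiplied by `y^κ` differ by a radial
vector, so twisting is invisible to the angular gradient. -/
theorem norm_sq_angularGrad (hu : ContDiffOn ℝ ∞ u (puncturedCylinder n T))
    (hp : p ∈ puncturedCylinder n T) :
    ‖angularGrad u p‖ ^ 2 = weight κ ‖p.2‖ *
      ((∑ i : Fin n, pd i.succ (untwist κ u) p * pd i.succ (untwist κ u) p)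
        - (‖p.2‖⁻¹ * ∑ i : Fin n, p.2 i * pd i.succ (untwist κ u) p) ^ 2) := by
  have hp2 : p.2 ≠ 0 := norm_pos_iff.1 hp.2.1
  have hm := (isOpen_puncturedCylinder n T).mem_nhds hp
  have hud : DifferentiableAt ℝ u p := (hu.differentiableOn (by simp)).differentiableAt hm
  have hvd : DifferentiableAt ℝ (untwist κ u) p :=
    ((contDiffOn_untwist hu).differentiableOn (by simp)).differentiableAt hm
  set V : EuclideanSpace ℝ (Fin n) := WithLp.toLp 2 fun i => pd i.succ (untwist κ u) p with hV
  have hd := hasDerivAt_one_sub_rpow κ hp.2.2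
  have hpd : ∀ i : Fin n, pd i.succ u p = yFun p ^ κ * pd i.succ (untwist κ u) p
      + -(κ * (1 - ‖p.2‖) ^ (κ - 1)) * ‖p.2‖⁻¹ * untwist κ u p * p.2 i := fun i => by
    rw [pd_congr_of_eqOn (b := fun q => (fun r => (1 - r) ^ κ) ‖q.2‖ * untwist κ u q)
      (fun q hq => eq_untwist hq) hp, pd_mul (differentiableAt_comp_norm hp2 hd) hvd, pd,
      fderiv_comp_norm_frame_succ hp2 hd, yFun]
    ring
  have hgrad : gradient (fun x => u (p.1, x)) p.2 = (yFun p ^ κ) • V +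
      (-(κ * (1 - ‖p.2‖) ^ (κ - 1)) * ‖p.2‖⁻¹ * untwist κ u p) • p.2 := by
    ext i
    have h1 : gradient (fun x => u (p.1, x)) p.2 i
        = fderiv ℝ (fun x => u (p.1, x)) p.2 (EuclideanSpace.single i 1) := by
      rw [← inner_gradient_left, EuclideanSpace.inner_single_right]
      simp
    have h2 : HasFDerivAt (fun x : EuclideanSpace ℝ (Fin n) => u (p.1, x))
        ((fderiv ℝ u p).comp (ContinuousLinearMap.inr ℝ ℝ _)) p.2 :=
      HasFDerivAt.comp p.2 (f := fun x => (p.1, x)) (g := u) hud.hasFDerivAt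
        (hasFDerivAt_prodMk_right p.1 p.2)
    rw [h1, h2.fderiv]
    have := hpd i
    simp only [pd, frame, Fin.cons_succ] at this
    simpa [hV, pd, frame] using this
  rw [angularGrad, hgrad, norm_sq_starProjection_orthogonal_singleton hp2, sq, yFun_rpow_sq hp,
    EuclideanSpace.norm_sq_eq]
  congr 2
  · exact Finset.sum_congr rfl fun i _ => by rw [Real.norm_eq_abs, sq_abs, sq]
  · congr 2
    simp [PiLp.inner_apply, hV, mul_comm]

end Pointwise

section Estimate

variable {n : ℕ} {T κ c : ℝ} {p : Spacetime n} {u : Spacetime n → ℝ}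

/-- The Hessian of `f` applied twice to the (raised) covector `V`. -/
theorem hessian_fFun_apply (hp : p ∈ puncturedCylinder n T) (V : Fin (n + 1) → ℝ) :
    ∑ α, ∑ β, eta n α * eta n β * (pd α (fGrad κ c β) p * V α * V β)
      = -2 * c * V 0 ^ 2
        + (-(2 * κ) * weight κ ‖p.2‖ / ((1 - ‖p.2‖) * ‖p.2‖) - weight κ ‖p.2‖ / ‖p.2‖ ^ 2)
          * ‖p.2‖ * (‖p.2‖⁻¹ * ∑ i : Fin n, p.2 i * V i.succ) ^ 2
        + gradProfile κ ‖p.2‖ * ∑ i : Fin n, V i.succ * V i.succ := by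
  have hp2 : p.2 ≠ 0 := norm_pos_iff.1 hp.2.1
  have hr : ‖p.2‖ ≠ 0 := hp.2.1.ne'
  have hd := hasDerivAt_gradProfile (κ := κ) hp.2.1 hp.2.2
  have h00 : pd 0 (fGrad (n := n) κ c 0) p = -2 * c := by
    simp only [fGrad, Fin.cons_zero]
    rw [pd_const_mul (by fun_prop), pd_time]
    simp [frame]
  have h0 : ∀ i : Fin n, pd i.succ (fGrad (n := n) κ c 0) p = 0 := fun i => by
    simp only [fGrad, Fin.cons_zero]
    rw [pd_const_mul (by fun_prop), pd_time]
    simp [frame]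
  have hi0 : ∀ i : Fin n, pd 0 (fGrad (n := n) κ c i.succ) p = 0 := fun i =>
    pd_zero_radial hp2 hd i
  have hij : ∀ i j : Fin n, pd j.succ (fGrad (n := n) κ c i.succ) p = _ := fun i j =>
    pd_succ_radial hp2 hd i j
  set A' := -(2 * κ) * weight κ ‖p.2‖ / ((1 - ‖p.2‖) * ‖p.2‖) - weight κ ‖p.2‖ / ‖p.2‖ ^ 2
  have hS : (∑ j : Fin n, ∑ i : Fin n, (p.2 i * p.2 j) * V j.succ * V i.succ)
      = (∑ i : Fin n, p.2 i * V i.succ) ^ 2 := by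
    rw [sq, Finset.sum_mul_sum]
    exact Finset.sum_congr rfl fun j _ => Finset.sum_congr rfl fun i _ => by ring
  have hT : ∀ i j : Fin n, pd j.succ (fGrad (n := n) κ c i.succ) p * V j.succ * V i.succ
      = A' * ‖p.2‖⁻¹ * ((p.2 i * p.2 j) * V j.succ * V i.succ)
        + if i = j then gradProfile κ ‖p.2‖ * (V i.succ * V i.succ) else 0 := fun i j => by
    rw [hij]
    split_ifs with h
    · subst h; ring
    · ring
  simp only [Fin.sum_univ_succ, eta_zero, eta_succ, h00, h0, hi0, one_mul, mul_one, zero_mul,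
    mul_zero, Finset.sum_const_zero, zero_add, add_zero, hT, Finset.sum_add_distrib,
    ← Finset.mul_sum, hS, Finset.sum_ite_eq', Finset.mem_univ, if_true]
  field_simp
  ring

/-- By design `w - z` is half of `ρ⁻¹ div(ρ∇f)`; the term `4c` is `-z`. -/
theorem sum_pd_weight_mul_fGrad (hp : p ∈ puncturedCylinder n T) :
    ∑ α, eta n α * pd α (fun q => weight κ ‖q.2‖ * fGrad κ c α q) p
      = 2 * weight κ ‖p.2‖ * (wProfile n κ c ‖p.2‖ + 4 * c) := by
  have hp2 : p.2 ≠ 0 := norm_pos_iff.1 hp.2.1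
  have hr : ‖p.2‖ ≠ 0 := hp.2.1.ne'
  have hy : 1 - ‖p.2‖ ≠ 0 := by have := hp.2.2; linarith
  have h0 : pd 0 (fun q : Spacetime n => weight κ ‖q.2‖ * fGrad κ c 0 q) p
      = -2 * c * weight κ ‖p.2‖ :=
    pd_zero_time_mul (weight κ) hp2 (hasDerivAt_weight κ hp.2.2) (-2 * c)
  have hi : ∀ i : Fin n, pd i.succ (fun q : Spacetime n => weight κ ‖q.2‖ * fGrad κ c i.succ q) p
      = pd i.succ (fun q : Spacetime n =>
        (fun s => weight κ s * gradProfile κ s) ‖q.2‖ * q.2 i) p := fun i => by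
    simp only [fGrad, Fin.cons_succ, mul_assoc]
  rw [sum_eta, h0, Finset.sum_congr rfl fun i _ => hi i,
    sum_pd_radial hp2 (hasDerivAt_weight_mul_gradProfile hp.2.1 hp.2.2)]
  simp only [gradProfile, wProfile]
  field_simp
  ring

/-- Half of this enters the lower bound with a minus sign. For `κ < 0` the `y^{-3}` coefficient is
positive, hence harmful; the Hardy correction is there to absorb it. -/
theorem sum_pd_weight_mul_wGrad (hp : p ∈ puncturedCylinder n T) :
    ∑ α, eta n α * pd α (fun q => weight κ ‖q.2‖ * wGrad κ α q) p
      = weight κ ‖p.2‖ * (-(4 * κ * (2 * κ - 1) ^ 2) * (weight κ ‖p.2‖ / (1 - ‖p.2‖) ^ 3)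
          + ((n : ℝ) - 1) * κ * (8 * κ - 3) * (weight κ ‖p.2‖ / ((1 - ‖p.2‖) ^ 2 * ‖p.2‖))
          + (4 - (n : ℝ)) * ((n : ℝ) - 1) * κ * (weight κ ‖p.2‖ / ((1 - ‖p.2‖) * ‖p.2‖ ^ 2))
          + ((n : ℝ) - 1) * (3 - (n : ℝ)) / 2 * (weight κ ‖p.2‖ / ‖p.2‖ ^ 3)) := by
  have hp2 : p.2 ≠ 0 := norm_pos_iff.1 hp.2.1
  obtain ⟨C', hC, hC'⟩ := hasDerivAt_weight_mul_wProfileDeriv (n := n) (κ := κ) hp.2.1 hp.2.2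
  have h0 : pd 0 (fun q : Spacetime n => weight κ ‖q.2‖ * wGrad κ 0 q) p = 0 := by
    simp [wGrad, radialField, pd]
  have hi : ∀ i : Fin n, pd i.succ (fun q : Spacetime n => weight κ ‖q.2‖ * wGrad κ i.succ q) p
      = pd i.succ (fun q : Spacetime n =>
        (fun s => weight κ s * (wProfileDeriv n κ s / s)) ‖q.2‖ * q.2 i) p := fun i => by
    simp only [wGrad, radialField, Fin.cons_succ, mul_assoc]
  rw [sum_eta, h0, Finset.sum_congr rfl fun i _ => hi i, sum_pd_radial hp2 hC, hC', neg_zero,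
    zero_add]

theorem contDiffOn_weight {k : WithTop ℕ∞} : ContDiffOn ℝ k (weight κ) (Ioo 0 1) :=
  ContDiffOn.rpow_const_of_ne (by fun_prop) fun r hr => by have := hr.2; linarith

theorem contDiffOn_gradProfile {k : WithTop ℕ∞} : ContDiffOn ℝ k (gradProfile κ) (Ioo 0 1) :=
  contDiffOn_weight.div contDiffOn_id fun _ hr => hr.1.ne'

theorem contDiffOn_wProfile {k : WithTop ℕ∞} : ContDiffOn ℝ k (wProfile n κ c) (Ioo 0 1) :=
  (contDiffOn_const.sub (contDiffOn_const.mul (contDiffOn_weight.div (by fun_prop)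
    fun _ hr => by have := hr.2; linarith))).add
    (contDiffOn_const.mul (contDiffOn_weight.div contDiffOn_id fun _ hr => hr.1.ne'))

theorem contDiffOn_wProfileDeriv {k : WithTop ℕ∞} :
    ContDiffOn ℝ k (wProfileDeriv n κ) (Ioo 0 1) := by
  have hy : ∀ r ∈ Ioo (0 : ℝ) 1, 1 - r ≠ 0 := fun r hr => by have := hr.2; linarith
  exact ((contDiffOn_const.mul (contDiffOn_weight.div (by fun_prop)
      fun r hr => pow_ne_zero 2 (hy r hr))).sub
    (contDiffOn_const.mul (contDiffOn_weight.div (by fun_prop)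
      fun r hr => mul_ne_zero (hy r hr) hr.1.ne'))).sub
    (contDiffOn_const.mul (contDiffOn_weight.div (by fun_prop)
      fun r hr => pow_ne_zero 2 hr.1.ne'))

theorem contDiffOn_hardyProfile {k : WithTop ℕ∞} :
    ContDiffOn ℝ k (hardyProfile κ) (Ioo 0 1) :=
  contDiffOn_const.mul ((contDiffOn_weight.mul contDiffOn_weight).div (by fun_prop)
    fun r hr => mul_ne_zero (pow_ne_zero 2 (by have := hr.2; linarith)) hr.1.ne')

theorem contDiffOn_radialField {k : WithTop ℕ∞} {G : ℝ → ℝ} (hG : ContDiffOn ℝ k G (Ioo 0 1))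
    (α : Fin (n + 1)) : ContDiffOn ℝ k (radialField G α) (puncturedCylinder n T) := by
  refine Fin.cases ?_ (fun i => ?_) α
  · exact contDiffOn_const
  · simp only [radialField, Fin.cons_succ]
    exact (contDiffOn_comp_norm hG).mul (by fun_prop)

theorem contDiffOn_fGrad {k : WithTop ℕ∞} (α : Fin (n + 1)) :
    ContDiffOn ℝ k (fGrad κ c α) (puncturedCylinder n T) := by
  refine Fin.cases ?_ (fun i => ?_) α
  · simp only [fGrad, Fin.cons_zero]
    fun_prop
  · simp only [fGrad, Fin.cons_succ]
    exact (contDiffOn_comp_norm contDiffOn_gradProfile).mul (by fun_prop)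

theorem contDiffOn_wGrad {k : WithTop ℕ∞} (α : Fin (n + 1)) :
    ContDiffOn ℝ k (wGrad κ α) (puncturedCylinder n T) :=
  contDiffOn_radialField (contDiffOn_wProfileDeriv.div contDiffOn_id fun _ hr => hr.1.ne') α

theorem contDiffOn_carlemanField (hu : ContDiffOn ℝ ∞ u (puncturedCylinder n T))
    (α : Fin (n + 1)) : ContDiffOn ℝ ∞ (carlemanField κ c u α) (puncturedCylinder n T) := by
  have hv := contDiffOn_untwist (κ := κ) hu
  have hv' := contDiffOn_pd hv
  have hρ : ContDiffOn ℝ ∞ (fun q : Spacetime n => weight κ ‖q.2‖) (puncturedCylinder n T) :=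
    contDiffOn_comp_norm contDiffOn_weight
  have hw : ContDiffOn ℝ ∞ (fun q : Spacetime n => wProfile n κ c ‖q.2‖) (puncturedCylinder n T) :=
    contDiffOn_comp_norm contDiffOn_wProfile
  have hf' : ∀ α, ContDiffOn ℝ ∞ (fGrad (n := n) κ c α) (puncturedCylinder n T) :=
    contDiffOn_fGrad
  have hw' : ∀ α, ContDiffOn ℝ ∞ (wGrad (n := n) κ α) (puncturedCylinder n T) :=
    contDiffOn_wGrad
  have hD := contDiffOn_radialField (n := n) (T := T) (k := ∞) (contDiffOn_hardyProfile (κ := κ)) α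
  have h1 := hf' α
  have h2 := hw' α
  have h3 := hv' α
  have hQ : ContDiffOn ℝ ∞ (fun q => ∑ β, eta n β * (fGrad κ c β q * pd β (untwist κ u) q))
      (puncturedCylinder n T) := ContDiffOn.sum fun β _ =>
    contDiffOn_const.mul ((hf' β).mul (hv' β))
  have hN : ContDiffOn ℝ ∞ (fun q => ∑ β, eta n β * (pd β (untwist κ u) q * pd β (untwist κ u) q))
      (puncturedCylinder n T) := ContDiffOn.sum fun β _ =>
    contDiffOn_const.mul ((hv' β).mul (hv' β))
  exact (contDiffOn_const.mul
    ((((contDiffOn_const.mul (hρ.mul h3)).mul (hQ.add (hw.mul hv))).add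
      ((contDiffOn_const.mul (hρ.mul h1)).mul hN)).add
      ((contDiffOn_const.mul (hρ.mul h2)).mul (hv.mul hv)))).add (hD.mul (hv.mul hv))

theorem divergence_carlemanField (hu : ContDiffOn ℝ ∞ u (puncturedCylinder n T))
    (hp : p ∈ puncturedCylinder n T) :
    divergence (carlemanField κ c u) p
      = divergence (energyField (fun q => weight κ ‖q.2‖) (fGrad κ c)
          (fun q => wProfile n κ c ‖q.2‖) (wGrad κ) (untwist κ u) (fun β => pd β (untwist κ u))) p
        + (2 * κ * (1 - 2 * κ) *
            (-(4 * κ - 2) * (weight κ ‖p.2‖ * weight κ ‖p.2‖ / ((1 - ‖p.2‖) ^ 3 * ‖p.2‖))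
            - weight κ ‖p.2‖ * weight κ ‖p.2‖ / ((1 - ‖p.2‖) ^ 2 * ‖p.2‖ ^ 2)) * ‖p.2‖
            + n * hardyProfile κ ‖p.2‖) * untwist κ u p ^ 2
        + 2 * hardyProfile κ ‖p.2‖ * untwist κ u p *
            ∑ i : Fin n, p.2 i * pd i.succ (untwist κ u) p := by
  have hp2 : p.2 ≠ 0 := norm_pos_iff.1 hp.2.1
  have hm := (isOpen_puncturedCylinder n T).mem_nhds hp
  have hvd : DifferentiableAt ℝ (untwist κ u) p :=
    ((contDiffOn_untwist hu).differentiableOn (by simp)).differentiableAt hm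
  have hD : ∀ α, DifferentiableAt ℝ (radialField (n := n) (hardyProfile κ) α) p := fun α =>
    ((contDiffOn_radialField (k := 1) contDiffOn_hardyProfile α).differentiableOn
      (by simp)).differentiableAt hm
  have hX : ∀ α, DifferentiableAt ℝ (carlemanField κ c u α) p := fun α =>
    ((contDiffOn_carlemanField hu α).differentiableOn (by simp)).differentiableAt hm
  have hE : ∀ α, DifferentiableAt ℝ (energyField (fun q => weight κ ‖q.2‖) (fGrad κ c)
      (fun q => wProfile n κ c ‖q.2‖) (wGrad κ) (untwist κ u)
      (fun β => pd β (untwist κ u)) α) p := fun α => by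
    -- The energy current is recovered as the whole field minus its Hardy part, both known to be
    -- differentiable.
    have h2 : DifferentiableAt ℝ (fun q => carlemanField κ c u α q
      - radialField (hardyProfile κ) α q * (untwist κ u q * untwist κ u q)) p :=
      (hX α).sub ((hD α).mul (hvd.mul hvd))
    simpa [carlemanField] using h2
  have e : ∀ α, pd α (carlemanField κ c u α) p
      = pd α (energyField (fun q => weight κ ‖q.2‖) (fGrad κ c)
          (fun q => wProfile n κ c ‖q.2‖) (wGrad κ) (untwist κ u)
          (fun β => pd β (untwist κ u)) α) p
        + pd α (radialField (hardyProfile κ) α) p * untwist κ u p ^ 2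
        + 2 * untwist κ u p * (radialField (hardyProfile κ) α p * pd α (untwist κ u) p) :=
    fun α => by
      unfold carlemanField
      rw [pd_add (hE α) ((hD α).fun_mul (hvd.fun_mul hvd)), pd_mul (hD α) (hvd.fun_mul hvd), pd_mul hvd hvd]
      ring
  have e0 : ∀ X : Fin (n + 1) → Spacetime n → ℝ, divergence X p = ∑ α, pd α (X α) p :=
    fun X => rfl
  have e1 : ∑ α, pd α (radialField (n := n) (hardyProfile κ) α) p
      = ∑ i : Fin n, pd i.succ (fun q : Spacetime n => hardyProfile κ ‖q.2‖ * q.2 i) p := by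
    rw [Fin.sum_univ_succ]
    have : pd 0 (radialField (n := n) (hardyProfile κ) 0) p = 0 := by simp [radialField, pd]
    rw [this, zero_add]
    rfl
  rw [sum_pd_radial hp2 (hasDerivAt_hardyProfile hp.2.1 hp.2.2)] at e1
  have e2 : ∑ α, radialField (n := n) (hardyProfile κ) α p * pd α (untwist κ u) p
      = hardyProfile κ ‖p.2‖ * ∑ i : Fin n, p.2 i * pd i.succ (untwist κ u) p := by
    rw [Fin.sum_univ_succ, Finset.mul_sum]
    simp only [radialField, Fin.cons_zero, Fin.cons_succ, zero_mul, zero_add, mul_assoc]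
  rw [e0, e0, Finset.sum_congr rfl fun α _ => e α, Finset.sum_add_distrib, Finset.sum_add_distrib,
    ← Finset.sum_mul, ← Finset.mul_sum, e1, e2]
  ring

/-- The pointwise form of the Carleman estimate. -/
theorem divergence_carlemanField_le (hκ : -(1 / 2) < κ) (hκ' : κ < 0)
    (hu : ContDiffOn ℝ ∞ u (puncturedCylinder n T)) (hp : p ∈ puncturedCylinder n T) :
    ((1 - 4 * c) * ‖angularGrad u p‖ ^ 2 + 2 * c * timeDeriv u p ^ 2
        - 4 * c * twistedD κ u p (radial p) ^ 2)
      - (1 / 2) * ((n : ℝ) - 1) * κ * (yFun p ^ (2 * κ - 2) * (‖p.2‖ ^ 2)⁻¹ *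
          (‖p.2‖ - ((n : ℝ) - 4) * yFun p) * u p ^ 2)
      + (1 / 4) * ((n : ℝ) - 1) * ((n : ℝ) - 3) *
          (yFun p ^ (2 * κ) * (‖p.2‖ ^ 3)⁻¹ * u p ^ 2)
      + divergence (carlemanField κ c u) p
      ≤ -(twistedWaveOp κ u p * multiplier κ (fFun κ c) (zFun c) u p) := by
  have hp2 : p.2 ≠ 0 := norm_pos_iff.1 hp.2.1
  have hm := (isOpen_puncturedCylinder n T).mem_nhds hp
  have hv := contDiffOn_untwist (κ := κ) hu
  have hvd : DifferentiableAt ℝ (untwist κ u) p :=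
    (hv.differentiableOn (by simp)).differentiableAt hm
  have hρd : DifferentiableAt ℝ (fun q : Spacetime n => weight κ ‖q.2‖) p :=
    differentiableAt_comp_norm hp2 (hasDerivAt_weight κ hp.2.2)
  have hwd : DifferentiableAt ℝ (fun q : Spacetime n => wProfile n κ c ‖q.2‖) p :=
    differentiableAt_comp_norm hp2 (hasDerivAt_wProfile hp.2.1 hp.2.2)
  have hE := divergence_energyField (f' := fGrad κ c) (w' := wGrad κ)
    (v' := fun β => pd β (untwist κ u)) hρd hwd hvd
    (fun α => ((contDiffOn_fGrad (k := 1) α).differentiableOn (by simp)).differentiableAt hm)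
    (fun α => ((contDiffOn_wGrad (k := 1) α).differentiableOn (by simp)).differentiableAt hm)
    (fun α => ((contDiffOn_pd hv α).differentiableOn (by simp)).differentiableAt hm)
    (fun α => rfl) (pd_wProfile hp) (pd_comm hv hp)
  rw [hessian_fFun_apply hp, sum_pd_weight_mul_fGrad hp, sum_pd_weight_mul_wGrad hp] at hE
  have hang := norm_sq_angularGrad (κ := κ) hu hp
  have hD : twistedD κ u p (radial p)
      = yFun p ^ κ * (‖p.2‖⁻¹ * ∑ i : Fin n, p.2 i * pd i.succ (untwist κ u) p) := by
    rw [twistedD_eq, clm_radial]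
    congr 1
    exact sum_radial_eq (fun α => pd α (untwist κ u) p) p
  have ht : timeDeriv u p = yFun p ^ κ * pd 0 (untwist κ u) p := by
    have hd := hasDerivAt_one_sub_rpow κ hp.2.2
    have h1 : timeDeriv u p = pd 0 u p := rfl
    rw [h1, pd_congr_of_eqOn (b := fun q => (fun r => (1 - r) ^ κ) ‖q.2‖ * untwist κ u q)
      (fun q hq => eq_untwist hq) hp, pd_mul (differentiableAt_comp_norm hp2 hd) hvd, pd,
      fderiv_comp_norm_frame_zero hp2 hd, yFun]
    ring
  have hPS : twistedWaveOp κ u p * multiplier κ (fFun κ c) (zFun c) u p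
      = (∑ α, eta n α * pd α (fun q => weight κ ‖q.2‖ * pd α (untwist κ u) q) p) *
        ((∑ β, eta n β * (fGrad κ c β p * pd β (untwist κ u) p))
        + wProfile n κ c ‖p.2‖ * untwist κ u p) := by
    rw [twistedWaveOp_eq hp, multiplier_eq hκ hp]
    have : yFun p ^ (-κ) * yFun p ^ κ = 1 := by
      rw [← Real.rpow_add (yFun_pos hp)]; simp
    linear_combination ((∑ α, eta n α * pd α (fun q => weight κ ‖q.2‖ * pd α (untwist κ u) q) p) *
        ((∑ β, eta n β * (fGrad κ c β p * pd β (untwist κ u) p))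
        + wProfile n κ c ‖p.2‖ * untwist κ u p)) * this
  have hu2 : u p ^ 2 = weight κ ‖p.2‖ * untwist κ u p ^ 2 := by
    rw [eq_untwist (κ := κ) (u := u) hp, ← yFun_rpow_sq hp]; ring
  have ht2 : timeDeriv u p ^ 2 = weight κ ‖p.2‖ * pd 0 (untwist κ u) p ^ 2 := by
    rw [ht, ← yFun_rpow_sq hp]; ring
  have hD2 : twistedD κ u p (radial p) ^ 2 = weight κ ‖p.2‖ *
      (‖p.2‖⁻¹ * ∑ i : Fin n, p.2 i * pd i.succ (untwist κ u) p) ^ 2 := by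
    rw [hD, ← yFun_rpow_sq hp]; ring
  have hy2 : yFun p ^ (2 * κ - 2) = weight κ ‖p.2‖ / (1 - ‖p.2‖) ^ 2 := by
    rw [Real.rpow_sub (yFun_pos hp), weight, yFun]
    norm_cast
  have hy1 : yFun p ^ (2 * κ) = weight κ ‖p.2‖ := rfl
  have hN : ∑ β, eta n β * (pd β (untwist κ u) p * pd β (untwist κ u) p)
      = -(pd 0 (untwist κ u) p * pd 0 (untwist κ u) p)
        + ∑ i : Fin n, pd i.succ (untwist κ u) p * pd i.succ (untwist κ u) p := sum_eta _
  -- Here `κ < 0` and `0 < y < 1` give `y^{2κ} ≥ 1 > r`; this lowers the angular coefficient `ρ/r -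
  -- 4c` to `1 - 4c`.
  have hs1 : 1 ≤ weight κ ‖p.2‖ / ‖p.2‖ := by
    have h1 : 1 ≤ weight κ ‖p.2‖ :=
      Real.one_le_rpow_of_pos_of_le_one_of_nonpos (yFun_pos hp) (by
        have := hp.2.1; linarith) (by linarith)
    rw [one_le_div hp.2.1]
    linarith [hp.2.2]
  have hs0 := weight_pos κ hp.2.2
  rw [divergence_carlemanField hu hp, hE, hN, hPS, hu2, ht2, hD2, hy2, hy1, yFun]
  have hang0 : 0 ≤ ‖angularGrad u p‖ ^ 2 := by positivity
  rw [hang] at hang0 ⊢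
  have hr0 := hp.2.1
  have hy0 : 0 < 1 - ‖p.2‖ := yFun_pos hp
  generalize (∑ α, eta n α * pd α (fun q => weight κ ‖q.2‖ * pd α (untwist κ u) q) p) = P
  generalize (∑ β, eta n β * (fGrad κ c β p * pd β (untwist κ u) p)) = Q
  have hσ : ∑ i : Fin n, p.2 i * pd i.succ (untwist κ u) p
      = ‖p.2‖ * (‖p.2‖⁻¹ * ∑ i : Fin n, p.2 i * pd i.succ (untwist κ u) p) := by
    field_simp
  -- The remaining sum not yet divided by `r` is the one in the Hardy cross term.
  nth_rw 4 [hσ]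
  generalize ‖p.2‖⁻¹ * ∑ i : Fin n, p.2 i * pd i.succ (untwist κ u) p = vr at *
  generalize ∑ i : Fin n, pd i.succ (untwist κ u) p * pd i.succ (untwist κ u) p = N at *
  generalize pd 0 (untwist κ u) p = v0 at *
  generalize untwist κ u p = v at *
  simp only [wProfile, hardyProfile, gradProfile] at *
  generalize weight κ ‖p.2‖ = s at *
  generalize 1 - ‖p.2‖ = y at *
  generalize ‖p.2‖ = r at *
  -- The two discarded quantities: the excess of the angular coefficient and the Hardy square. The
  -- constant `1 - 2κ` makes the square absorb exactly the `y^{-3}` terms. Their sum is the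
  -- difference of the two sides, as an identity in which `r`, `y` and `s` are independent.
  have g1 : 0 ≤ (s / r - 1) * (s * (N - vr ^ 2)) := mul_nonneg (by linarith) hang0
  have g2 : 0 ≤ (-(2 * κ)) * (s ^ 2 / y * (vr + (1 - 2 * κ) * v / y) ^ 2) :=
    mul_nonneg (by linarith) (by positivity)
  rw [← sub_nonneg]
  refine (add_nonneg g1 g2).trans_eq ?_
  field_simp
  ring

end Estimate

/-! ### Boundary flux, integrability and signs of the normal -/

section Assembly

variable {n : ℕ} {T δ κ c : ℝ} {p : Spacetime n} {u : Spacetime n → ℝ}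

theorem fderiv_radial (F : Spacetime n → ℝ) (p : Spacetime n) :
    fderiv ℝ F p (radial p) = ∑ i : Fin n, ‖p.2‖⁻¹ * p.2 i * pd i.succ F p :=
  clm_radial _ _

/-- On the lateral boundary the Carleman field has the flux density of the boundary terms. -/
theorem radialPart_carlemanField (hκ : -(1 / 2) < κ) (hp : p ∈ puncturedCylinder n T) :
    radialPart (carlemanField κ c u) p
      = -1 * (multiplier κ (fFun κ c) (zFun c) u p * twistedD κ u p (radial p))
        + 1 / 2 * (fderiv ℝ (fFun κ c) p (radial p)
            * contract (twistedD κ u p) (twistedD κ u p))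
        + 1 / 2 * (fderiv ℝ (wFun κ (fFun κ c) (zFun c)) p (radial p) * u p ^ 2)
        + 2 * κ * (2 * κ - 1) *
            (yFun p ^ (2 * κ - 2) * fderiv ℝ yFun p (radial p) * u p ^ 2) := by
  have hr : ‖p.2‖ ≠ 0 := hp.2.1.ne'
  have hy : 1 - ‖p.2‖ ≠ 0 := by have := hp.2.2; linarith
  have hrad : ∀ G : ℝ, ∑ i : Fin n, ‖p.2‖⁻¹ * p.2 i * (G * p.2 i) = G * ‖p.2‖ := fun G => by
    have : ∀ i : Fin n, ‖p.2‖⁻¹ * p.2 i * (G * p.2 i) = ‖p.2‖⁻¹ * G * (p.2 i * p.2 i) :=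
      fun i => by ring
    rw [Finset.sum_congr rfl fun i _ => this i, ← Finset.mul_sum, sum_sq_eq_norm_sq]
    field_simp
  have hf : fderiv ℝ (fFun κ c) p (radial p) = weight κ ‖p.2‖ := by
    simp only [fderiv_radial, pd_fFun hκ hp, fGrad, Fin.cons_succ]
    rw [hrad, gradProfile]
    field_simp
  have hw : fderiv ℝ (wFun κ (fFun κ c) (zFun c)) p (radial p) = wProfileDeriv n κ ‖p.2‖ := by
    simp only [fderiv_radial, pd_congr_of_eqOn (fun q hq => wFun_eq (c := c) hκ hq) hp,
      pd_wProfile hp, wGrad, radialField, Fin.cons_succ]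
    rw [hrad]
    field_simp
  have hyr : fderiv ℝ yFun p (radial p) = -1 := by
    simp only [fderiv_radial, pd_yFun_succ hp, ← mul_assoc (-1 : ℝ)]
    rw [hrad]
    field_simp
  have hD : twistedD κ u p (radial p)
      = yFun p ^ κ * ∑ i : Fin n, ‖p.2‖⁻¹ * p.2 i * pd i.succ (untwist κ u) p := by
    rw [twistedD_eq, clm_radial]
    rfl
  have hN : contract (twistedD κ u p) (twistedD κ u p) = weight κ ‖p.2‖ *
      ∑ β, eta n β * (pd β (untwist κ u) p * pd β (untwist κ u) p) := by
    rw [contract_eq, ← yFun_rpow_sq hp, Finset.mul_sum]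
    refine Finset.sum_congr rfl fun β _ => ?_
    simp only [twistedD_eq, pd]
    ring
  have hu2 : u p ^ 2 = weight κ ‖p.2‖ * untwist κ u p ^ 2 := by
    rw [eq_untwist (κ := κ) (u := u) hp, ← yFun_rpow_sq hp]; ring
  have hy2 : yFun p ^ (2 * κ - 2) = weight κ ‖p.2‖ / (1 - ‖p.2‖) ^ 2 := by
    rw [Real.rpow_sub (yFun_pos hp), weight, yFun]
    norm_cast
  set Q := ∑ β, eta n β * (fGrad κ c β p * pd β (untwist κ u) p) with hQ
  -- The Hardy part has radial component `2κ(1-2κ) y^{2κ-2} u²`; since `∂_r y = -1`, it becomes the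
  -- last boundary term.
  set N := ∑ β, eta n β * (pd β (untwist κ u) p * pd β (untwist κ u) p) with hNdef
  set v := untwist κ u p with hv
  have e : ∀ i : Fin n, ‖p.2‖⁻¹ * p.2 i * carlemanField κ c u i.succ p
      = -(weight κ ‖p.2‖ * (Q + wProfile n κ c ‖p.2‖ * v))
          * (‖p.2‖⁻¹ * p.2 i * pd i.succ (untwist κ u) p)
        + ‖p.2‖⁻¹ * p.2 i * ((1 / 2 * weight κ ‖p.2‖ * gradProfile κ ‖p.2‖ * N
          + 1 / 2 * weight κ ‖p.2‖ * (wProfileDeriv n κ ‖p.2‖ / ‖p.2‖) * v ^ 2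
          + hardyProfile κ ‖p.2‖ * v ^ 2) * p.2 i) := fun i => by
    simp only [carlemanField, energyField, ← hQ, ← hNdef, ← hv, eta_succ]
    simp only [fGrad, wGrad, radialField, Fin.cons_succ]
    ring
  rw [radialPart, Finset.sum_congr rfl fun i _ => e i, Finset.sum_add_distrib, ← Finset.mul_sum,
    hrad, hf, hw, hyr, hN, hD, multiplier_eq hκ hp, hu2, hy2, ← hQ, ← hv]
  generalize ∑ i : Fin n, ‖p.2‖⁻¹ * p.2 i * pd i.succ (untwist κ u) p = vr
  rw [show -1 * (yFun p ^ κ * (Q + wProfile n κ c ‖p.2‖ * v) * (yFun p ^ κ * vr))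
    = -(yFun p ^ κ * yFun p ^ κ) * (Q + wProfile n κ c ‖p.2‖ * v) * vr by ring, yFun_rpow_sq hp,
    gradProfile, hardyProfile]
  field_simp
  ring

theorem fderiv_eq_zero_of_vanish {F : Spacetime n → ℝ}
    (h : ∀ p ∈ puncturedCylinder n T, T - δ < |p.1| → F p = 0)
    (hp : p ∈ puncturedCylinder n T) (ht : T - δ < |p.1|) : fderiv ℝ F p = 0 := by
  have ho : IsOpen {q : Spacetime n | T - δ < |q.1|} := isOpen_lt (by fun_prop) (by fun_prop)
  have : F =ᶠ[nhds p] fun _ => 0 := by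
    filter_upwards [(isOpen_puncturedCylinder n T).mem_nhds hp, ho.mem_nhds ht] with q hq hq'
      using h q hq hq'
  rw [this.fderiv_eq]
  simp

theorem untwist_vanish (h : ∀ p ∈ puncturedCylinder n T, T - δ < |p.1| → u p = 0) :
    ∀ p ∈ puncturedCylinder n T, T - δ < |p.1| → untwist κ u p = 0 := fun p hp ht => by
  rw [untwist, h p hp ht, mul_zero]

theorem pd_vanish {F : Spacetime n → ℝ} (α : Fin (n + 1))
    (h : ∀ p ∈ puncturedCylinder n T, T - δ < |p.1| → F p = 0) :
    ∀ p ∈ puncturedCylinder n T, T - δ < |p.1| → pd α F p = 0 := fun p hp ht => by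
  rw [pd, fderiv_eq_zero_of_vanish h hp ht]
  rfl

theorem continuousOn_radial : ContinuousOn (radial (n := n)) (puncturedCylinder n T) := by
  unfold radial
  have h : ContinuousOn (fun p : Spacetime n => ‖p.2‖⁻¹) (puncturedCylinder n T) :=
    ContinuousOn.inv₀ (by fun_prop) fun q hq => hq.2.1.ne'
  exact continuousOn_const.prodMk (h.smul continuousOn_snd)

theorem continuousOn_fderiv_radial {F : Spacetime n → ℝ}
    (hF : ContDiffOn ℝ ∞ F (puncturedCylinder n T)) :
    ContinuousOn (fun q => fderiv ℝ F q (radial q)) (puncturedCylinder n T) :=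
  (hF.continuousOn_fderiv_of_isOpen (isOpen_puncturedCylinder n T) (by simp)).clm_apply
    continuousOn_radial

theorem Admissible.of_continuousOn {F : Spacetime n → ℝ}
    (hF : ContinuousOn F (puncturedCylinder n T))
    (h : ∀ p ∈ puncturedCylinder n T, T - δ < |p.1| → F p = 0) : Admissible T δ 0 F :=
  ⟨contDiffOn_zero.2 hF, h⟩

theorem Admissible.continuousOn {k : WithTop ℕ∞} {F : Spacetime n → ℝ} (hF : Admissible T δ k F) :
    ContinuousOn F (puncturedCylinder n T) := hF.contDiffOn.continuousOn

theorem Admissible.mul_left {F G : Spacetime n → ℝ} (hF : Admissible T δ 0 F)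
    (hG : ContinuousOn G (puncturedCylinder n T)) : Admissible T δ 0 (fun p => G p * F p) :=
  .of_continuousOn (hG.mul hF.continuousOn) fun p hp ht => by rw [hF.eq_zero p hp ht, mul_zero]

theorem Admissible.add {F G : Spacetime n → ℝ} (hF : Admissible T δ 0 F)
    (hG : Admissible T δ 0 G) : Admissible T δ 0 (fun p => F p + G p) :=
  .of_continuousOn (hF.continuousOn.add hG.continuousOn) fun p hp ht => by
    rw [hF.eq_zero p hp ht, hG.eq_zero p hp ht, add_zero]

theorem Admissible.sum {ι : Type*} {s : Finset ι} {F : ι → Spacetime n → ℝ}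
    (hF : ∀ i, Admissible T δ 0 (F i)) : Admissible T δ 0 (fun p => ∑ i ∈ s, F i p) :=
  .of_continuousOn (continuousOn_finsetSum _ fun i _ => (hF i).continuousOn) fun p hp ht =>
    Finset.sum_eq_zero fun i _ => (hF i).eq_zero p hp ht

theorem Admissible.congr {F G : Spacetime n → ℝ} (hF : Admissible T δ 0 F)
    (h : EqOn G F (puncturedCylinder n T)) : Admissible T δ 0 G :=
  .of_continuousOn (hF.continuousOn.congr h) fun p hp ht => by
    rw [h hp, hF.eq_zero p hp ht]

theorem Admissible.of_le {k m : WithTop ℕ∞} {F : Spacetime n → ℝ} (hF : Admissible T δ k F)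
    (h : m ≤ k) : Admissible T δ m F := ⟨hF.contDiffOn.of_le h, hF.eq_zero⟩

theorem Admissible.pd {F : Spacetime n → ℝ} (hF : Admissible T δ ∞ F) (α : Fin (n + 1)) :
    Admissible T δ ∞ (pd α F) :=
  ⟨contDiffOn_pd hF.contDiffOn α, pd_vanish α hF.eq_zero⟩

theorem Admissible.untwist (hu : Admissible T δ ∞ u) : Admissible T δ ∞ (untwist κ u) :=
  ⟨contDiffOn_untwist hu.contDiffOn, untwist_vanish hu.eq_zero⟩

theorem continuousOn_yFun_rpow (a : ℝ) :
    ContinuousOn (fun q : Spacetime n => yFun q ^ a) (puncturedCylinder n T) :=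
  (contDiffOn_yFun_rpow (k := 0) a).continuousOn

theorem Admissible.sq (hu : Admissible T δ 0 u) : Admissible T δ 0 (fun p => u p ^ 2) :=
  (hu.mul_left hu.continuousOn).congr fun p _ => pow_two (u p)

theorem admissible_multiplier (hκ : -(1 / 2) < κ) (hu : Admissible T δ ∞ u) :
    Admissible T δ 0 (multiplier κ (fFun κ c) (zFun c) u) :=
  Admissible.congr (((Admissible.sum (s := Finset.univ) fun β =>
      (((hu.untwist (κ := κ)).pd β).of_le (by simp)).mul_left
        (contDiffOn_fGrad (κ := κ) (c := c) (k := 0) β).continuousOn |>.mul_left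
        (continuousOn_const (c := eta n β))).add
    (((hu.untwist (κ := κ)).of_le (by simp)).mul_left
      (contDiffOn_comp_norm (contDiffOn_wProfile (c := c) (k := 0))).continuousOn)).mul_left
    (continuousOn_yFun_rpow κ)) fun p hp => multiplier_eq hκ hp

theorem admissible_twistedWaveOp (hu : Admissible T δ ∞ u) :
    Admissible T δ 0 (twistedWaveOp κ u) :=
  Admissible.congr ((Admissible.sum (s := Finset.univ) fun α =>
      Admissible.mul_left (Admissible.of_le (Admissible.pd
        (F := fun q => weight κ ‖q.2‖ * TwistedWave.pd α (TwistedWave.untwist κ u) q)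
        ⟨(contDiffOn_comp_norm contDiffOn_weight).mul ((hu.untwist (κ := κ)).pd α).contDiffOn,
          fun p hp ht => by rw [((hu.untwist (κ := κ)).pd α).eq_zero p hp ht, mul_zero]⟩ α)
        (by simp)) (continuousOn_const (c := eta n α))).mul_left
    (continuousOn_yFun_rpow (-κ))) fun p hp => twistedWaveOp_eq hp

theorem admissible_twistedD_radial (hu : Admissible T δ ∞ u) :
    Admissible T δ 0 (fun p => twistedD κ u p (radial p)) :=
  .of_continuousOn ((continuousOn_yFun_rpow κ).mul
    (continuousOn_fderiv_radial (hu.untwist (κ := κ)).contDiffOn)) fun p hp ht => by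
      rw [twistedD_eq, fderiv_eq_zero_of_vanish (hu.untwist (κ := κ)).eq_zero hp ht]
      simp

theorem admissible_contract_twistedD (hu : Admissible T δ ∞ u) :
    Admissible T δ 0 (fun p => contract (twistedD κ u p) (twistedD κ u p)) := by
  have h : ∀ β, Admissible T δ 0 (fun p => twistedD κ u p (frame n β)) := fun β =>
    (((hu.untwist (κ := κ)).pd β).of_le (by simp)).mul_left (continuousOn_yFun_rpow κ)
  exact (Admissible.sum (s := Finset.univ) fun β =>
    ((h β).mul_left (h β).continuousOn).mul_left (continuousOn_const (c := eta n β))).congr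
      fun p _ => contract_eq _ _

theorem admissible_norm_sq_angularGrad (hu : Admissible T δ ∞ u) :
    Admissible T δ 0 (fun p => ‖angularGrad u p‖ ^ 2) := by
  -- The angular gradient does not involve `κ`, so its formula may be used with `κ = 0`.
  have h : ∀ β, Admissible T δ 0 (pd β (untwist 0 u)) := fun β =>
    ((hu.untwist (κ := 0)).pd β).of_le (by simp)
  have hx : ∀ i : Fin n, ContinuousOn (fun p : Spacetime n => p.2 i) (puncturedCylinder n T) :=
    fun i => by fun_prop
  have hi : ContinuousOn (fun p : Spacetime n => ‖p.2‖⁻¹) (puncturedCylinder n T) :=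
    ContinuousOn.inv₀ (by fun_prop) fun q hq => hq.2.1.ne'
  refine Admissible.congr (((Admissible.sum (s := Finset.univ) fun i : Fin n =>
      (h i.succ).mul_left (h i.succ).continuousOn).add
    (((Admissible.sum (s := Finset.univ) fun i : Fin n => (h i.succ).mul_left (hx i)).mul_left
      hi).sq.mul_left (continuousOn_const (c := -1)))).mul_left
    (contDiffOn_comp_norm (contDiffOn_weight (κ := 0) (k := 0))).continuousOn) fun p hp => ?_
  simp only [norm_sq_angularGrad (κ := 0) hu.contDiffOn hp]
  ring

theorem contDiffOn_fFun : ContDiffOn ℝ ∞ (fFun (n := n) κ c) (puncturedCylinder n T) :=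
  (contDiffOn_const.mul (contDiffOn_yFun_rpow _)).sub (by fun_prop)

theorem contDiffOn_yFun : ContDiffOn ℝ ∞ (yFun (n := n)) (puncturedCylinder n T) :=
  contDiffOn_comp_norm (G := fun r => 1 - r) (by fun_prop)

theorem contDiffOn_wFun (hκ : -(1 / 2) < κ) :
    ContDiffOn ℝ ∞ (wFun (n := n) κ (fFun κ c) (zFun c)) (puncturedCylinder n T) :=
  (contDiffOn_comp_norm contDiffOn_wProfile).congr fun _ hq => wFun_eq hκ hq

theorem admissible_carlemanField (hu : Admissible T δ ∞ u) (α : Fin (n + 1)) :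
    Admissible T δ ∞ (carlemanField κ c u α) := by
  refine ⟨contDiffOn_carlemanField hu.contDiffOn α, fun p hp ht => ?_⟩
  have h0 := (hu.untwist (κ := κ)).eq_zero p hp ht
  have h1 : ∀ β, pd β (untwist κ u) p = 0 := fun β =>
    ((hu.untwist (κ := κ)).pd β).eq_zero p hp ht
  simp [carlemanField, energyField, h0, h1]

theorem lateralIntegral_const_mul (r a : ℝ) (F : Spacetime n → ℝ) :
    lateralIntegral T r (fun p => a * F p) = a * lateralIntegral T r F := by
  simp only [lateralIntegral, integral_const_mul]
  ring

/-- The normal is `-∂_r` on the inner component, so densities odd in the normal give a difference of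
radial fluxes. The condition `ε < 1/2` keeps the outer radius distinct from `ε`. -/
theorem gammaIntegral_eq {ε : ℝ} (hε : 0 < ε) (hε' : ε < 1 / 2)
    {B : Spacetime n → Spacetime n → ℝ} (hB : ∀ p X, B p (-X) = -B p X) :
    gammaIntegral T ε (fun p => B p (outwardNormal ε p))
      = lateralIntegral T (1 - ε) (fun p => B p (radial p))
        - lateralIntegral T ε (fun p => B p (radial p)) := by
  have h1 : lateralIntegral T ε (fun p => B p (outwardNormal ε p))
      = lateralIntegral T ε (fun p => -1 * B p (radial p)) :=
    lateralIntegral_congr hε.le fun p _ hp => by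
      rw [outwardNormal, if_pos hp, hB, neg_one_mul]
  have h2 : lateralIntegral T (1 - ε) (fun p => B p (outwardNormal ε p))
      = lateralIntegral T (1 - ε) (fun p => B p (radial p)) :=
    lateralIntegral_congr (by linarith) fun p _ hp => by
      rw [outwardNormal, if_neg (by rw [hp]; linarith)]
  rw [gammaIntegral, h1, h2, lateralIntegral_const_mul]
  ring

end Assembly

end TwistedWave

/-! ### The integrated estimate -/

theorem proposition3p3 (n : ℕ) (hn : 1 ≤ n) (T κ c : ℝ) (hT : 0 < T)
    (hκ : -(1 / 2) < κ) (hκ' : κ < 0) (hc : 0 < c)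
    (u : Spacetime n → ℝ) (hu : ContDiffOn ℝ ∞ u (cylinder n T))
    (δ : ℝ) (hδ : 0 < δ)
    (hsupp : ∀ p ∈ cylinder n T, T - δ ≤ |p.1| → u p = 0)
    (ε : ℝ) (hε : 0 < ε) (hε' : ε < 1 / 2) :
    -(∫ p in cylinderEps n T ε,
        twistedWaveOp κ u p * multiplier κ (fFun κ c) (zFun c) u p) ≥
      (∫ p in cylinderEps n T ε,
        ((1 - 4 * c) * ‖angularGrad u p‖ ^ 2 + 2 * c * timeDeriv u p ^ 2
          - 4 * c * twistedD κ u p (radial p) ^ 2))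
      - (1 / 2) * ((n : ℝ) - 1) * κ *
          (∫ p in cylinderEps n T ε,
            yFun p ^ (2 * κ - 2) * (‖p.2‖ ^ 2)⁻¹ *
              (‖p.2‖ - ((n : ℝ) - 4) * yFun p) * u p ^ 2)
      + (1 / 4) * ((n : ℝ) - 1) * ((n : ℝ) - 3) *
          (∫ p in cylinderEps n T ε, yFun p ^ (2 * κ) * (‖p.2‖ ^ 3)⁻¹ * u p ^ 2)
      - gammaIntegral T ε (fun p =>
          multiplier κ (fFun κ c) (zFun c) u p * twistedD κ u p (outwardNormal ε p))
      + (1 / 2) * gammaIntegral T ε (fun p =>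
          fderiv ℝ (fFun κ c) p (outwardNormal ε p)
            * contract (twistedD κ u p) (twistedD κ u p))
      + (1 / 2) * gammaIntegral T ε (fun p =>
          fderiv ℝ (wFun κ (fFun κ c) (zFun c)) p (outwardNormal ε p) * u p ^ 2)
      + 2 * κ * (2 * κ - 1) * gammaIntegral T ε (fun p =>
          yFun p ^ (2 * κ - 2) * fderiv ℝ yFun p (outwardNormal ε p) * u p ^ 2) := by
  have hu' : Admissible T δ ∞ u :=
    ⟨hu.mono fun p hp => ⟨hp.1, hp.2.2⟩, fun p hp ht => hsupp p ⟨hp.1, hp.2.2⟩ ht.le⟩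
  have hu0 : Admissible T δ 0 u := hu'.of_le (by simp)
  have hinv : ∀ k : ℕ, ContinuousOn (fun p : Spacetime n => (‖p.2‖ ^ k)⁻¹)
      (puncturedCylinder n T) := fun k =>
    ContinuousOn.inv₀ (by fun_prop) fun q hq => pow_ne_zero k hq.2.1.ne'
  have hyc : ContinuousOn (yFun (n := n)) (puncturedCylinder n T) := contDiffOn_yFun.continuousOn
  have a0 : Admissible T δ 0 (fun p =>
      twistedWaveOp κ u p * multiplier κ (fFun κ c) (zFun c) u p) :=
    (admissible_multiplier hκ hu').mul_left (admissible_twistedWaveOp hu').continuousOn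
  have a1 : Admissible T δ 0 (fun p => (1 - 4 * c) * ‖angularGrad u p‖ ^ 2
      + 2 * c * timeDeriv u p ^ 2 - 4 * c * twistedD κ u p (radial p) ^ 2) := by
    have ht : Admissible T δ 0 (timeDeriv u) := (hu'.pd 0).of_le (by simp)
    refine ((((admissible_norm_sq_angularGrad hu').mul_left
      (continuousOn_const (c := 1 - 4 * c))).add
      (ht.sq.mul_left (continuousOn_const (c := 2 * c)))).add
      ((admissible_twistedD_radial (κ := κ) hu').sq.mul_left
        (continuousOn_const (c := -(4 * c))))).congr fun p _ => ?_
    ring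
  have a2 : Admissible T δ 0 (fun p => yFun p ^ (2 * κ - 2) * (‖p.2‖ ^ 2)⁻¹ *
      (‖p.2‖ - ((n : ℝ) - 4) * yFun p) * u p ^ 2) :=
    hu0.sq.mul_left (((continuousOn_yFun_rpow _).mul (hinv 2)).mul
      (ContinuousOn.sub (by fun_prop) (continuousOn_const.mul hyc)))
  have a3 : Admissible T δ 0 (fun p => yFun p ^ (2 * κ) * (‖p.2‖ ^ 3)⁻¹ * u p ^ 2) :=
    hu0.sq.mul_left ((continuousOn_yFun_rpow _).mul (hinv 3))
  have a4 : Admissible T δ 0 (divergence (carlemanField κ c u)) :=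
    Admissible.sum (s := Finset.univ) fun α =>
      ((admissible_carlemanField hu' α).pd α).of_le (by simp)
  have b1 : Admissible T δ 0 (fun p =>
      multiplier κ (fFun κ c) (zFun c) u p * twistedD κ u p (radial p)) :=
    (admissible_twistedD_radial hu').mul_left (admissible_multiplier hκ hu').continuousOn
  have b2 : Admissible T δ 0 (fun p => fderiv ℝ (fFun κ c) p (radial p)
      * contract (twistedD κ u p) (twistedD κ u p)) :=
    (admissible_contract_twistedD hu').mul_left (continuousOn_fderiv_radial contDiffOn_fFun)
  have b3 : Admissible T δ 0 (fun p =>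
      fderiv ℝ (wFun κ (fFun κ c) (zFun c)) p (radial p) * u p ^ 2) :=
    hu0.sq.mul_left (continuousOn_fderiv_radial (contDiffOn_wFun hκ))
  have b4 : Admissible T δ 0 (fun p =>
      yFun p ^ (2 * κ - 2) * fderiv ℝ yFun p (radial p) * u p ^ 2) :=
    hu0.sq.mul_left ((continuousOn_yFun_rpow _).mul (continuousOn_fderiv_radial contDiffOn_yFun))
  have hcm : ∀ {F : Spacetime n → ℝ} (a : ℝ), Admissible T δ 0 F →
      Admissible T δ 0 (fun p => a * F p) := fun a hF => hF.mul_left continuousOn_const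
  have hL : ∀ r ∈ Ioo (0 : ℝ) 1, lateralIntegral T r (radialPart (carlemanField κ c u)) = _ :=
    fun r hr => by
      refine (lateralIntegral_congr hr.1.le fun p ht hp =>
        radialPart_carlemanField hκ ⟨ht, by rwa [hp]⟩).trans ?_
      rw [(((hcm _ b1).add (hcm _ b2)).add (hcm _ b3)).lateralIntegral_add hδ (hcm _ b4) hr,
        ((hcm _ b1).add (hcm _ b2)).lateralIntegral_add hδ (hcm _ b3) hr,
        (hcm _ b1).lateralIntegral_add hδ (hcm _ b2) hr]
  have hdiv := setIntegral_divergence hn hδ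
    (fun α => (admissible_carlemanField (κ := κ) (c := c) hu' α).of_le (by simp)) hε hε'
  rw [hL ε ⟨hε, by linarith⟩, hL (1 - ε) ⟨by linarith, by linarith⟩] at hdiv
  simp only [lateralIntegral_const_mul] at hdiv
  have i0 := a0.integrableOn hδ hε
  have i1 := a1.integrableOn hδ hε
  have i2 := (hcm ((1 / 2) * ((n : ℝ) - 1) * κ) a2).integrableOn hδ hε
  have i3 := (hcm ((1 / 4) * ((n : ℝ) - 1) * ((n : ℝ) - 3)) a3).integrableOn hδ hε
  have i4 := a4.integrableOn hδ hε
  -- The pointwise inequality is integrated, and the integral of the divergence is then replaced by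
  -- the flux difference.
  have hmono := setIntegral_mono_on (((i1.sub i2).add i3).add i4) i0.neg
    (isOpen_cylinderEps n T ε).measurableSet fun p hp =>
      divergence_carlemanField_le hκ hκ' hu'.contDiffOn (cylinderEps_subset hε hp)
  rw [integral_add' ((i1.sub i2).add i3) i4, integral_add' (i1.sub i2) i3, integral_sub' i1 i2,
    integral_neg', integral_const_mul, integral_const_mul, hdiv] at hmono
  -- Each boundary density is linear in the normal, hence odd in it.
  rw [gammaIntegral_eq (B := fun p X => multiplier κ (fFun κ c) (zFun c) u p * twistedD κ u p X)
      hε hε' (fun p X => by simp),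
    gammaIntegral_eq (B := fun p X => fderiv ℝ (fFun κ c) p X
      * contract (twistedD κ u p) (twistedD κ u p)) hε hε' (fun p X => by simp),
    gammaIntegral_eq (B := fun p X => fderiv ℝ (wFun κ (fFun κ c) (zFun c)) p X * u p ^ 2)
      hε hε' (fun p X => by simp),
    gammaIntegral_eq (B := fun p X => yFun p ^ (2 * κ - 2) * fderiv ℝ yFun p X * u p ^ 2)
      hε hε' (fun p X => by simp)]
  linarith
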